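/- Graphs are finite and undirected, and may have loops and multiple edges. For a graph $G$, $d_G(v)$ denotes the degree of a vertex $v$ (a loop at $v$ counts twice), $d_G(X)$ denotes the number of edges of $G$ with exactly one end in $X\subseteq V(G)$, and $G[X]$ is the induced subgraph on $X$. A factor of $G$ is a spanning subgraph; for $V_0\subseteq V(G)$ and $f:V_0\to\mathbb{Z}_2$, a factor $F$ is a $V_0$-partial $f$-parity factor if $d_F(v)\equiv f(v)\pmod 2$ for all $v\in V_0$. Theorem. Let $G$ be a connected graph, let $V_0,V_1,V_1'$ be three pairwise disjoint subsets of $V(G)$, let $f:V_0\to\mathbb{Z}_2$ be a mapping, and let $\varepsilon$ be a real number with $0<\varepsilon<1$. Assume that $\sum_{v\in V_0}f(v)\equiv 0\pmod 2$ or $V_0\neq V(G)$. Suppose that every nonempty proper subset $X$ of $V_0$ such that (a) $G[X]$ is connected, and (b) $G[X]$ is not bipartite, or there is a $v\in X$ for which $\varepsilon d_G(v)$ is not an integer with the same parity as $f(v)$, satisfies both of the following: $d_G(X)\ge 1/\varepsilon$ if $\sum_{v\in X}f(v)$ is odd, and $d_G(X)\ge 1/(1-\varepsilon)$ if $\sum_{v\in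 X}(d_G(v)-f(v))$ is odd. Then $G$ has a $V_0$-partial $f$-parity factor $F$ such that (i) for all $v\in V_0$, $\lfloor\varepsilon d_G(v)\rfloor-1\le d_F(v)\le\lceil\varepsilon d_G(v)\rceil+1$ (equivalently, $|d_F(v)-\varepsilon d_G(v)|<2$) and $d_F(v)\equiv f(v)\pmod 2$; (ii) for all $v\in V_1$, $\lceil\varepsilon d_G(v)\rceil-1\le d_F(v)\le\lceil\varepsilon d_G(v)\rceil$; (iii) for all $v\in V_1'$, $\lfloor\varepsilon d_G(v)\rfloor\le d_F(v)\le\lfloor\varepsilon d_G(v)\rfloor+1$. Furthermore, for any given vertex $z\in V_0$, $F$ can be chosen, at will, so that in addition $d_F(z)\ge\lceil\varepsilon d_G(z)\rceil-1$, or so that in addition $d_F(z)\le\lfloor\varepsilon d_G(z)\rfloor+1$. -/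

import Mathlib

open scoped Graph

namespace Graph

variable {α β : Type*}

/-- The degree `d_G(v)` of a vertex `v` in a multigraph: the number of edges incident with `v`,
every loop at `v` being counted twice. -/
noncomputable def degree (G : Graph α β) (v : α) : ℕ :=
  (G.incidenceSet v).ncard + (G.loopSet v).ncard

/-- `d_G(A)`: the number of edges of `G` with exactly one end in `A`. -/
noncomputable def cutDegree (G : Graph α β) (A : Set α) : ℕ :=
  {e | ∃ x ∈ A, ∃ y ∉ A, G.IsLink e x y}.ncard

/-- A graph is connected if it has a vertex and any two of its vertices are joined by a walk. -/
def IsConnected (G : Graph α β) : Prop :=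
  V(G).Nonempty ∧ ∀ u ∈ V(G), ∀ v ∈ V(G), Relation.ReflTransGen G.Adj u v

/-- A graph is bipartite if it has a proper 2-colouring of its vertices; in particular a bipartite
graph has no loops. -/
def IsBipartite (G : Graph α β) : Prop :=
  ∃ c : α → Bool, ∀ x y, G.Adj x y → c x ≠ c y

/-- `F` is a `V₀`-partial `f`-parity factor of `G`: a spanning subgraph with
`d_F(v) ≡ f(v) (mod 2)` for all `v ∈ V₀`. Only the values of `f` on `V₀` matter. -/
def IsPartialParityFactor (F G : Graph α β) (V₀ : Finset α) (f : α → ZMod 2) : Prop :=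
  F ≤s G ∧ ∀ v ∈ V₀, (F.degree v : ZMod 2) = f v

/-- `F` is a `V₀`-partial `f`-parity factor of `G` whose degrees are close to `ε d_G(v)`:
within `[⌊ε d_G(v)⌋ - 1, ⌈ε d_G(v)⌉ + 1]` on `V₀`, within `[⌈ε d_G(v)⌉ - 1, ⌈ε d_G(v)⌉]` on `V₁`,
and within `[⌊ε d_G(v)⌋, ⌊ε d_G(v)⌋ + 1]` on `V₁'`. -/
def IsEpsilonParityFactor (F G : Graph α β) (V₀ V₁ V₁' : Finset α) (f : α → ZMod 2) (ε : ℝ) :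
    Prop :=
  F.IsPartialParityFactor G V₀ f ∧
  (∀ v ∈ V₀, ⌊ε * G.degree v⌋ - 1 ≤ (F.degree v : ℤ) ∧
    (F.degree v : ℤ) ≤ ⌈ε * G.degree v⌉ + 1) ∧
  (∀ v ∈ V₁, ⌈ε * G.degree v⌉ - 1 ≤ (F.degree v : ℤ) ∧
    (F.degree v : ℤ) ≤ ⌈ε * G.degree v⌉) ∧
  (∀ v ∈ V₁', ⌊ε * G.degree v⌋ ≤ (F.degree v : ℤ) ∧
    (F.degree v : ℤ) ≤ ⌊ε * G.degree v⌋ + 1)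

end Graph

/-!
The theorem is deduced from Tutte's `1`-factor theorem by a weight count.

After the unconstrained vertices have been added to `V₁'`, every vertex `v` has a degree window:
`{g(v), g(v) + s(v)}` with `s(v) ∈ {0, 2}` and `g(v) ≡ f(v)` if `v ∈ V₀`, and two consecutive
integers otherwise. The windows can be chosen so that `g(v) ≤ ε d(v) ≤ g(v) + s(v)` for all `v`; for
the last part of the theorem the window at `z` is chosen so that it misses `ε d(z)` by less than
`1`. Factors with degrees in the windows correspond to the perfect matchings of a gadget graph
(`GadgetData.graph`): the half-edges at `v` and `s(v)` optional vertices, the outer vertices, are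
joined to `d(v) - g(v)` inner vertices, the two halves of every edge are joined, and the optional
vertices are joined at each vertex of `V₀` separately but globally outside `V₀`, so that the parity
is free there.

If there is no perfect matching, Tutte's theorem gives a set `U` of gadget vertices whose deletion
leaves more than `|U|` odd components. Let the deleted vertices pay for weights of the components: a
surviving half-edge at a vertex that lost all its inner vertices has weight `1 - ε`, a deleted
half-edge contributes `ε` to the component of its other half, and if inner and outer vertices
survive at its vertex, it contributes the remaining `1 - ε`, and every other vertex deleted there
contributes `1`, to the component that contains the rest of the gadget. As `ε d(v)` lies in the
window at `v`, the total weight is at most `|U|`, plus the loss at `z`, which is less than `1`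
(`GadgetData.sum_wt_add_sum_vwt_le`). On the other hand, apart from the one component that meets the
global clique, an odd component of weight less than `1` must consist of the gadgets of a set `X ⊆
V₀` that induces a connected subgraph, and either all of its boundary edges have weight `ε` and
`f(X)` is odd, or all of them have weight `1 - ε` and `f(X) + d(X)` is odd (`GadgetData.le_compWt`,
`GadgetData.odd_sum_add_cut`). This contradicts the hypothesis on `X`. When that hypothesis is void
because `X` induces a bipartite graph and all `ε d(v)` are integers congruent to `f(v)`, the weights
`ε d(v)` of the two colour classes have different sums, and the boundary of `X` has weight at least
`1` without any hypothesis (`GadgetData.one_le_mul_cut`). Only `X = V₀` can remain; the weight is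
then still positive, and there is no loss at `z ∈ X`. Hence there are fewer than `|U| + 2` odd
components, and a parity argument gives the contradiction (`GadgetData.exists_factor`).
-/

set_option linter.unusedSectionVars false

/-! ### Tutte's theorem in terms of finite vertex sets -/

namespace SimpleGraph

/-- Adjacency in `G - U`, for a set `U` of deleted vertices. -/
def AdjOff {V : Type*} (G : SimpleGraph V) (U : Finset V) (x y : V) : Prop :=
  G.Adj x y ∧ x ∉ U ∧ y ∉ U

/-- `W` is an odd component of `G - U`: it has an odd number of vertices, avoids `U`, is closed
under adjacency outside `U`, and any two of its vertices are joined outside `U`. -/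
structure IsOddComponentOff {V : Type*} (G : SimpleGraph V) (U W : Finset V) : Prop where
  odd_card : Odd W.card
  disjoint : Disjoint W U
  closed : ∀ x ∈ W, ∀ y ∉ U, G.Adj x y → y ∈ W
  connected : ∀ x ∈ W, ∀ y ∈ W, Relation.ReflTransGen (G.AdjOff U) x y

/-- The nontrivial direction of Tutte's theorem, together with the parity of the deficiency. -/
theorem exists_family_isOddComponentOff {V : Type*} [Fintype V] [DecidableEq V]
    (G : SimpleGraph V) (h : ∀ M : G.Subgraph, ¬ M.IsPerfectMatching) :
    ∃ (U : Finset V) (𝒲 : Finset (Finset V)),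
      (∀ W ∈ 𝒲, ∀ W' ∈ 𝒲, W ≠ W' → Disjoint W W') ∧
      (∀ W ∈ 𝒲, G.IsOddComponentOff U W) ∧ U.card < 𝒲.card ∧
      (Even (Fintype.card V) → Even (U.card + 𝒲.card)) := by
  classical
  have h1 : ¬ ∃ M : G.Subgraph, M.IsPerfectMatching := by rintro ⟨M, hM⟩; exact h M hM
  rw [tutte] at h1
  push Not at h1
  obtain ⟨u, hu⟩ := h1
  unfold IsTutteViolator at hu
  set K := ((⊤ : G.Subgraph).deleteVerts u).coe with hK
  let U : Finset V := u.toFinset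
  have hmemU : ∀ x, x ∈ U ↔ x ∈ u := by simp [U]
  have hv : ∀ x, x ∈ ((⊤ : G.Subgraph).deleteVerts u).verts ↔ x ∉ U := by simp [hmemU]
  let Φ : K.ConnectedComponent → Finset V := fun c => (Subtype.val '' c.supp).toFinset
  have hΦ : ∀ c x, x ∈ Φ c ↔ ∃ hx, K.connectedComponentMk ⟨x, hx⟩ = c := by
    intro c x
    simp [Φ]
  have hΦcard : ∀ c, (Φ c).card = c.supp.ncard := by
    intro c
    rw [← Set.ncard_image_of_injective c.supp Subtype.val_injective, Set.ncard_eq_toFinset_card']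
  have hdisj : ∀ c c', c ≠ c' → Disjoint (Φ c) (Φ c') := by
    intro c c' hcc
    rw [Finset.disjoint_left]
    intro x hx hx'
    rw [hΦ] at hx hx'
    obtain ⟨_, hx⟩ := hx
    obtain ⟨_, hx'⟩ := hx'
    exact hcc (hx.symm.trans hx')
  have hinj : Set.InjOn Φ K.oddComponents := by
    intro c hc c' _ hcc
    by_contra hne
    have := hdisj c c' hne
    rw [← hcc, disjoint_self] at this
    have h0 : (Φ c).card = 0 := by rw [this]; rfl
    rw [hΦcard] at h0
    have hc' : Odd c.supp.ncard := hc
    rw [h0] at hc'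
    exact absurd hc' (by decide)
  have hUcard : U.card = u.ncard := (Set.ncard_eq_toFinset_card' u).symm
  have hWcard : (Φ '' K.oddComponents).toFinset.card = K.oddComponents.ncard := by
    rw [← hinj.ncard_image, Set.ncard_eq_toFinset_card']
  refine ⟨U, (Φ '' K.oddComponents).toFinset, ?_, ?_, ?_, ?_⟩
  · intro W hW W' hW' hne
    simp only [Set.mem_toFinset, Set.mem_image] at hW hW'
    obtain ⟨c, _, rfl⟩ := hW
    obtain ⟨c', _, rfl⟩ := hW'
    exact hdisj c c' (fun h => hne (by rw [h]))
  · intro W hW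
    simp only [Set.mem_toFinset, Set.mem_image] at hW
    obtain ⟨c, hc, rfl⟩ := hW
    refine ⟨?_, ?_, ?_, ?_⟩
    · rw [hΦcard]; exact hc
    · rw [Finset.disjoint_left]
      intro x hx
      rw [hΦ] at hx
      exact (hv x).1 hx.1
    · intro x hx y hy hxy
      rw [hΦ] at hx ⊢
      obtain ⟨hx, rfl⟩ := hx
      refine ⟨(hv y).2 hy, ?_⟩
      rw [ConnectedComponent.eq]
      apply Adj.reachable
      have h1 := (hv x).1 hx
      rw [hmemU] at h1 hy
      simp [hK, hxy.symm, h1, hy]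
    · intro x hx y hy
      rw [hΦ] at hx hy
      obtain ⟨hx, rfl⟩ := hx
      obtain ⟨hy, he⟩ := hy
      rw [ConnectedComponent.eq, reachable_iff_reflTransGen] at he
      have key : ∀ a b, Relation.ReflTransGen K.Adj a b →
          Relation.ReflTransGen (G.AdjOff U) a.1 b.1 := by
        intro a b hab
        induction hab with
        | refl => exact .refl
        | @tail b c _ hbc ih =>
          refine ih.tail ⟨?_, (hv _).1 b.2, (hv _).1 c.2⟩
          have := Subgraph.coe_adj_sub _ _ _ hbc
          exact this
      exact key _ _ ((reachable_iff_reflTransGen _ _).1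
        ((reachable_iff_reflTransGen _ _).2 he).symm)
  · rwa [hWcard, hUcard]
  · intro hev
    rw [hWcard]
    have h2 := odd_ncard_oddComponents (G := K)
    have h3 : Nat.card ((⊤ : G.Subgraph).deleteVerts u).verts = Fintype.card V - U.card := by
      rw [Nat.card_coe_set_eq, ← Finset.card_compl, ← Set.ncard_coe_finset]
      congr 1
      ext x
      simp [hmemU]
    rw [h3] at h2
    have h4 := Finset.card_le_univ U
    rw [← Nat.not_even_iff_odd, ← Nat.not_even_iff_odd, not_iff_not, Nat.even_sub h4] at h2
    rw [Nat.even_add]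
    tauto

end SimpleGraph

/-! ### The matching gadget of a degree-constrained factor problem -/

/-- The other half of the edge that contains a given half-edge. -/
def flipHalf {E : Type*} (h : E × Bool) : E × Bool := (h.1, !h.2)

@[simp] lemma flipHalf_flipHalf {E : Type*} (h : E × Bool) : flipHalf (flipHalf h) = h := by
  simp [flipHalf]

lemma flipHalf_ne {E : Type*} (h : E × Bool) : flipHalf h ≠ h := by
  rcases h with ⟨e, b⟩
  simp [flipHalf]

lemma flipHalf_involutive {E : Type*} : Function.Involutive (flipHalf (E := E)) := flipHalf_flipHalf

/-- A multigraph on `V` with edges `E`, given by the ends `t (e, false)`, `t (e, true)` of each edge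
`e` (so a loop has two half-edges at its vertex), together with a degree window at each vertex:
the degrees allowed at `v` are `d(v) - N v, …, d(v) - N v + s v`, restricted to those congruent to
`d(v) - N v` modulo `2` if `v ∈ V₀`. The number `r` of auxiliary vertices serves to correct the
parity of the order of the gadget graph. -/
structure GadgetData (V E : Type*) where
  t : E × Bool → V
  V₀ : Finset V
  N : V → ℕ
  s : V → ℕ
  r : ℕ

namespace GadgetData

variable {V E : Type*} (D : GadgetData V E)

/-- The vertices of the gadget graph: the half-edges and `s v` optional vertices (the outer vertices
at `v`), `N v` inner vertices at each vertex `v`, and `r` auxiliary vertices. -/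
abbrev Vert : Type _ := (E × Bool) ⊕ (Σ v, Fin (D.s v)) ⊕ (Σ v, Fin (D.N v)) ⊕ Fin D.r

/-- A half-edge as a vertex of the gadget graph. -/
abbrev he (h : E × Bool) : D.Vert := .inl h
/-- An optional vertex as a vertex of the gadget graph. -/
abbrev opt (p : Σ v, Fin (D.s v)) : D.Vert := .inr (.inl p)
/-- An inner vertex as a vertex of the gadget graph. -/
abbrev inn (i : Σ v, Fin (D.N v)) : D.Vert := .inr (.inr (.inl i))
/-- An auxiliary vertex as a vertex of the gadget graph. -/
abbrev aux (k : Fin D.r) : D.Vert := .inr (.inr (.inr k))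

/-- Adjacency in the gadget graph: the two halves of an edge are joined, every outer vertex at `v`
is joined to every inner vertex at `v`, the optional vertices at `v` are joined to each other, and
the optional vertices at vertices outside `V₀` form a clique with the auxiliary vertices. -/
def Adj : D.Vert → D.Vert → Prop
  | .inl h, .inl h' => h' = flipHalf h
  | .inl h, .inr (.inr (.inl i)) => D.t h = i.1
  | .inr (.inr (.inl i)), .inl h => D.t h = i.1
  | .inr (.inl p), .inr (.inr (.inl i)) => p.1 = i.1
  | .inr (.inr (.inl i)), .inr (.inl p) => p.1 = i.1
  | .inr (.inl p), .inr (.inl q) => p ≠ q ∧ (p.1 = q.1 ∨ (p.1 ∉ D.V₀ ∧ q.1 ∉ D.V₀))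
  | .inr (.inl p), .inr (.inr (.inr _)) => p.1 ∉ D.V₀
  | .inr (.inr (.inr _)), .inr (.inl p) => p.1 ∉ D.V₀
  | .inr (.inr (.inr k)), .inr (.inr (.inr l)) => k ≠ l
  | _, _ => False

/-- The gadget graph. Its perfect matchings correspond to the factors whose degrees lie in the
prescribed windows: an edge belongs to the factor if its two halves are matched to each other. -/
def graph : SimpleGraph D.Vert where
  Adj := D.Adj
  symm := ⟨by
    rintro (h | p | i | k) (h' | q | j | l) hh <;> simp only [Adj] at hh ⊢
    · rw [hh, flipHalf_flipHalf]
    · exact hh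
    · exact ⟨hh.1.symm, hh.2.imp Eq.symm And.symm⟩
    · exact hh
    · exact hh
    · exact hh
    · exact hh
    · exact hh
    · exact hh.symm⟩
  loopless := ⟨by
    rintro (h | p | i | k) hh <;> simp only [Adj] at hh
    · exact flipHalf_ne h hh.symm
    · exact hh.1 rfl
    · exact hh rfl⟩

instance instDecidableEqVert [DecidableEq V] [DecidableEq E] : DecidableEq D.Vert :=
  inferInstanceAs (DecidableEq ((E × Bool) ⊕ (Σ v, Fin (D.s v)) ⊕ (Σ v, Fin (D.N v)) ⊕ Fin D.r))

variable [Fintype V] [Fintype E] [DecidableEq V] [DecidableEq E]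

/-- The degree of a vertex, as the number of its half-edges. -/
def deg (v : V) : ℕ := (Finset.univ.filter fun h => D.t h = v).card

lemma card_filter_sigma_fin (n : V → ℕ) (v : V) (P : (Σ v, Fin (n v)) → Prop) [DecidablePred P] :
    (Finset.univ.filter fun p : Σ v, Fin (n v) => p.1 = v ∧ P p).card =
      (Finset.univ.filter fun p : Fin (n v) => P ⟨v, p⟩).card := by
  symm
  apply Finset.card_bij (fun p _ => ⟨v, p⟩)
  · intro p hp
    simpa using hp
  · intro p _ q _ h
    simpa using h
  · rintro ⟨w, p⟩ hp
    simp only [Finset.mem_filter, Finset.mem_univ, true_and] at hp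
    obtain ⟨rfl, hp⟩ := hp
    exact ⟨p, by simpa using hp, rfl⟩

/-- A perfect matching of the gadget graph yields a factor with the prescribed degrees: at `v`, the
`N v` inner vertices are matched to the half-edges left out of the factor and to `s v - k'` of the
optional vertices, and on `V₀` the number `k'` of remaining optional vertices is even, because they
are matched to each other. -/
theorem exists_factor_of_isPerfectMatching (hs : ∀ v ∈ D.V₀, Even (D.s v))
    (M : D.graph.Subgraph) (hM : M.IsPerfectMatching) :
    ∃ F : Finset E, ∀ v, ∃ k ≤ D.s v, (v ∈ D.V₀ → Even k) ∧
      (Finset.univ.filter fun h => D.t h = v ∧ h.1 ∈ F).card + D.N v = D.deg v + k := by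
  classical
  rw [SimpleGraph.Subgraph.isPerfectMatching_iff] at hM
  choose m hm hm' using hM
  have hadj : ∀ x, D.Adj x (m x) := fun x => (hm x).adj_sub
  have hmm : ∀ x, m (m x) = x := fun x => (hm' (m x) x (hm x).symm).symm
  let F : Finset E := Finset.univ.filter fun e => m (D.he (e, false)) = D.he (e, true)
  have hF : ∀ h : E × Bool, h.1 ∈ F ↔ m (D.he h) = D.he (flipHalf h) := by
    rintro ⟨e, b⟩
    cases b
    · simp [F, flipHalf]
    · simp only [F, Finset.mem_filter, Finset.mem_univ, true_and, flipHalf, Bool.not_true]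
      constructor
      · intro h
        rw [← h, hmm]
      · intro h
        rw [← h, hmm]
  have hhe : ∀ h : E × Bool, h.1 ∉ F ↔ ∃ i, m (D.he h) = D.inn i := by
    intro h
    rw [hF]
    have := hadj (D.he h)
    rcases hx : m (D.he h) with h' | p | i | k
    · rw [hx] at this
      simp only [Adj] at this
      simp [this]
    · rw [hx] at this
      simp only [Adj] at this
    · simp
    · rw [hx] at this
      simp only [Adj] at this
  have hpar : ∀ v ∈ D.V₀, Even (Finset.univ.filter fun p : Σ v, Fin (D.s v) =>
      p.1 = v ∧ ¬ ∃ i, m (D.opt p) = D.inn i).card := by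
    intro v hv
    have key : ∀ p : Σ v, Fin (D.s v), p.1 = v → (¬ ∃ i, m (D.opt p) = D.inn i) →
        ∃ q, m (D.opt p) = D.opt q ∧ q.1 = v ∧ q ≠ p := by
      intro p hp hi
      have := hadj (D.opt p)
      rcases hx : m (D.opt p) with h' | q | i | k <;> rw [hx] at this
      · simp only [Adj] at this
      · simp only [Adj] at this
        refine ⟨q, rfl, ?_, this.1.symm⟩
        rcases this.2 with h | h
        · rw [← h, hp]
        · rw [hp] at h
          exact absurd hv h.1
      · exact absurd ⟨i, hx⟩ hi
      · simp only [Adj] at this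
        rw [hp] at this
        exact absurd hv this
    choose! σ hσ1 hσ2 hσ3 using key
    rw [even_iff_two_dvd, ← ZMod.natCast_eq_zero_iff, Finset.card_eq_sum_ones, Nat.cast_sum]
    refine Finset.sum_involution (fun p _ => σ p) ?_ ?_ ?_ ?_
    · intro _ _; decide
    · intro p hp _
      simp only [Finset.mem_filter, Finset.mem_univ, true_and] at hp
      exact hσ3 p hp.1 hp.2
    · intro p hp
      simp only [Finset.mem_filter, Finset.mem_univ, true_and] at hp ⊢
      refine ⟨hσ2 p hp.1 hp.2, ?_⟩
      rintro ⟨i, hi⟩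
      rw [← hσ1 p hp.1 hp.2, hmm] at hi
      simp at hi
    · intro p hp
      simp only [Finset.mem_filter, Finset.mem_univ, true_and] at hp
      have h1 := hσ1 p hp.1 hp.2
      have h2 : ¬ ∃ i, m (D.opt (σ p)) = D.inn i := by
        rintro ⟨i, hi⟩
        rw [← h1, hmm] at hi
        simp at hi
      have h3 := hσ1 (σ p) (hσ2 p hp.1 hp.2) h2
      rw [← h1, hmm] at h3
      simpa using h3.symm
  refine ⟨F, fun v => ⟨(Finset.univ.filter fun p : Σ v, Fin (D.s v) =>
      p.1 = v ∧ ∃ i, m (D.opt p) = D.inn i).card, ?_, ?_, ?_⟩⟩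
  · rw [card_filter_sigma_fin]
    exact (Finset.card_le_univ _).trans (by simp)
  · intro hv
    have h1 := card_filter_sigma_fin D.s v (fun _ => True)
    have h2 := Finset.card_filter_add_card_filter_not (s := Finset.univ.filter
      fun p : Σ v, Fin (D.s v) => p.1 = v) (fun p => ∃ i, m (D.opt p) = D.inn i)
    rw [Finset.filter_filter, Finset.filter_filter] at h2
    simp only [and_true, Finset.filter_true, Finset.card_univ, Fintype.card_fin] at h1
    rw [h1] at h2
    have h3 := hs v hv
    rw [← h2, Nat.even_add] at h3
    exact h3.2 (hpar v hv)
  · -- the inner vertices at `v` are matched bijectively to outer vertices at `v`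
    have hbij : (Finset.univ.filter fun x : D.Vert => (∃ i, m x = D.inn i ∧ i.1 = v)).card =
        D.N v := by
      have h1 := card_filter_sigma_fin D.N v (fun _ => True)
      simp only [and_true, Finset.filter_true, Finset.card_univ, Fintype.card_fin] at h1
      rw [← h1]
      symm
      apply Finset.card_bij (fun i _ => m (D.inn i))
      · intro i hi
        simp only [Finset.mem_filter, Finset.mem_univ, true_and] at hi ⊢
        exact ⟨i, hmm _, hi⟩
      · intro i _ j _ hij
        have := congrArg m hij
        rw [hmm, hmm] at this
        simpa using this
      · intro x hx
        simp only [Finset.mem_filter, Finset.mem_univ, true_and] at hx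
        obtain ⟨i, hi, hiv⟩ := hx
        exact ⟨i, by simpa using hiv, by rw [← hi, hmm]⟩
    have hsplit : (Finset.univ.filter fun x : D.Vert => (∃ i, m x = D.inn i ∧ i.1 = v)).card =
        (Finset.univ.filter fun h => D.t h = v ∧ h.1 ∉ F).card +
        (Finset.univ.filter fun p : Σ v, Fin (D.s v) =>
          p.1 = v ∧ ∃ i, m (D.opt p) = D.inn i).card := by
      simp only [Finset.card_filter, Fintype.sum_sum_type]
      have e1 : ∀ h, (∃ i, m (.inl h) = D.inn i ∧ i.1 = v) ↔ (D.t h = v ∧ h.1 ∉ F) := by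
        intro h
        rw [hhe]
        constructor
        · rintro ⟨i, hi, rfl⟩
          have := hadj (D.he h)
          rw [hi] at this
          exact ⟨this, i, hi⟩
        · rintro ⟨hv, i, hi⟩
          have := hadj (D.he h)
          rw [hi] at this
          exact ⟨i, hi, by rw [← hv]; exact this.symm⟩
      have e2 : ∀ p, (∃ i, m (.inr (.inl p)) = D.inn i ∧ i.1 = v) ↔
          (p.1 = v ∧ ∃ i, m (D.opt p) = D.inn i) := by
        intro p
        constructor
        · rintro ⟨i, hi, rfl⟩
          have := hadj (D.opt p)
          rw [hi] at this
          exact ⟨this, i, hi⟩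
        · rintro ⟨hv, i, hi⟩
          have := hadj (D.opt p)
          rw [hi] at this
          exact ⟨i, hi, by rw [← hv]; exact this.symm⟩
      have e3 : ∀ j, ¬ ∃ i, m (.inr (.inr (.inl j))) = D.inn i ∧ i.1 = v := by
        rintro j ⟨i, hi, _⟩
        have := hadj (D.inn j)
        rw [hi] at this
        exact this
      have e4 : ∀ j, ¬ ∃ i, m (.inr (.inr (.inr j))) = D.inn i ∧ i.1 = v := by
        rintro j ⟨i, hi, _⟩
        have := hadj (D.aux j)
        rw [hi] at this
        exact this
      simp only [e1, e2, e3, e4, if_false, Finset.sum_const_zero, add_zero]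
    have hd := Finset.card_filter_add_card_filter_not (s := Finset.univ.filter
      fun h => D.t h = v) (fun h => h.1 ∈ F)
    rw [Finset.filter_filter, Finset.filter_filter] at hd
    unfold deg
    omega

end GadgetData

/-! ### Weights on the gadget graph -/

namespace GadgetData

variable {V E : Type*} (D : GadgetData V E)

/-- All outer vertices at `v` are deleted. -/
def IsS (U : Finset D.Vert) (v : V) : Prop :=
  (∀ h, D.t h = v → D.he h ∈ U) ∧ ∀ p : Σ v, Fin (D.s v), p.1 = v → D.opt p ∈ U

/-- All inner vertices at `v`, but not all outer vertices at `v`, are deleted. -/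
def IsT (U : Finset D.Vert) (v : V) : Prop :=
  ¬ D.IsS U v ∧ ∀ i : Σ v, Fin (D.N v), i.1 = v → D.inn i ∈ U

/-- Both an outer and an inner vertex at `v` survive the deletion of `U`; then all surviving
vertices of the gadget at `v` are in one component. -/
def IsC (U : Finset D.Vert) (v : V) : Prop :=
  ¬ D.IsS U v ∧ ∃ i : Σ v, Fin (D.N v), i.1 = v ∧ D.inn i ∉ U

variable [Fintype V] [Fintype E] [DecidableEq V] [DecidableEq E]

/-- The number of deleted half-edges at `v`. -/
def delHalf (U : Finset D.Vert) (v : V) : ℕ :=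
  (Finset.univ.filter fun h => D.t h = v ∧ D.he h ∈ U).card

/-- The number of deleted optional vertices at `v`. -/
def delOpt (U : Finset D.Vert) (v : V) : ℕ :=
  (Finset.univ.filter fun p : Fin (D.s v) => D.opt ⟨v, p⟩ ∈ U).card

/-- The number of deleted inner vertices at `v`. -/
def delInn (U : Finset D.Vert) (v : V) : ℕ :=
  (Finset.univ.filter fun i : Fin (D.N v) => D.inn ⟨v, i⟩ ∈ U).card

open scoped Classical in
/-- The share of its edge that a half-edge pays for. -/
noncomputable def share (U : Finset D.Vert) (ε : ℝ) (h : E × Bool) : ℝ :=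
  if D.he h ∈ U then ε else if D.IsT U (D.t h) then 1 - ε else 0

open scoped Classical in
/-- The weight that a vertex of the gadget graph contributes to its component. -/
noncomputable def wt (U : Finset D.Vert) (ε : ℝ) : D.Vert → ℝ
  | .inl h => if D.he h ∈ U then 0 else
      D.share U ε h + if D.he (flipHalf h) ∈ U then ε else 0
  | .inr (.inl p) => if D.opt p ∈ U then 0 else if D.IsT U p.1 then D.delOpt U p.1 else 0
  | .inr (.inr (.inl i)) => if D.inn i ∈ U then 0 else if D.IsS U i.1 then 1 else 0
  | .inr (.inr (.inr _)) => 0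

open scoped Classical in
/-- The weight that a vertex `v` contributes to the component that contains the rest of its
gadget: the part of the deleted vertices at `v` that is not needed to pay for the half-edges. -/
noncomputable def vwt (U : Finset D.Vert) (ε : ℝ) (v : V) : ℝ :=
  if D.IsC U v then (1 - ε) * D.delHalf U v + D.delOpt U v + D.delInn U v else 0

open scoped Classical in
/-- The amount by which `ε d(v)` exceeds the upper end of the degree window at `v`, if all outer
vertices at `v` are deleted, or by which it falls short of the lower end, if all inner vertices are
deleted. It may be negative. -/
noncomputable def loss (U : Finset D.Vert) (ε : ℝ) (v : V) : ℝ :=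
  if D.IsS U v then ε * D.deg v - (D.deg v - D.N v + D.s v)
  else if D.IsT U v then (D.deg v - D.N v) - ε * D.deg v else 0

lemma isT_or_isC {U : Finset D.Vert} {v : V} (h : ¬ D.IsS U v) : D.IsT U v ∨ D.IsC U v := by
  by_cases h1 : ∀ i : Σ v, Fin (D.N v), i.1 = v → D.inn i ∈ U
  · exact .inl ⟨h, h1⟩
  · push Not at h1
    exact .inr ⟨h, h1⟩

lemma not_isT_of_isC {U : Finset D.Vert} {v : V} (h : D.IsC U v) : ¬ D.IsT U v := by
  intro hT
  obtain ⟨i, hi, hiU⟩ := h.2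
  exact hiU (hT.2 i hi)

lemma share_nonneg (U : Finset D.Vert) {ε : ℝ} (h0 : 0 ≤ ε) (h1 : ε ≤ 1) (h : E × Bool) :
    0 ≤ D.share U ε h := by
  unfold share
  split_ifs <;> linarith

lemma wt_nonneg (U : Finset D.Vert) {ε : ℝ} (h0 : 0 ≤ ε) (h1 : ε ≤ 1) (x : D.Vert) :
    0 ≤ D.wt U ε x := by
  rcases x with h | p | i | k
  · simp only [wt]
    have := D.share_nonneg U h0 h1 h
    split_ifs <;> linarith
  · simp only [wt]
    split_ifs <;> first | exact le_rfl | positivity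
  · simp only [wt]
    split_ifs <;> norm_num
  · simp [wt]

lemma vwt_nonneg (U : Finset D.Vert) {ε : ℝ} (h1 : ε ≤ 1) (v : V) : 0 ≤ D.vwt U ε v := by
  have h1' : 0 ≤ 1 - ε := by linarith
  unfold vwt
  split_ifs
  · positivity
  · exact le_rfl

lemma sum_wt_he_le (U : Finset D.Vert) {ε : ℝ} (h0 : 0 ≤ ε) :
    ∑ h, D.wt U ε (D.he h) ≤ ∑ h, D.share U ε h := by
  have e1 : ∑ h, D.share U ε h = ∑ h, (if D.he h ∈ U then 0 else D.share U ε h) +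
      ∑ h : E × Bool, (if D.he h ∈ U then ε else 0) := by
    rw [← Finset.sum_add_distrib]
    refine Finset.sum_congr rfl fun h _ => ?_
    split_ifs with hU
    · simp [share, hU]
    · simp
  have e2 : ∑ h : E × Bool, (if D.he h ∈ U then ε else 0) =
      ∑ h : E × Bool, (if D.he (flipHalf h) ∈ U then ε else 0) :=
    (Equiv.sum_comp (flipHalf_involutive.toPerm flipHalf)
      (fun h : E × Bool => if D.he h ∈ U then ε else 0)).symm
  rw [e1, e2, ← Finset.sum_add_distrib]
  refine Finset.sum_le_sum fun h _ => ?_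
  simp only [wt]
  split_ifs <;> simp [h0]

lemma sum_del_le_card (U : Finset D.Vert) :
    ∑ v, (D.delHalf U v + D.delOpt U v + D.delInn U v) ≤ U.card := by
  have e0 : U.card = ∑ x : D.Vert, if x ∈ U then 1 else 0 := by simp
  rw [e0]
  simp only [Fintype.sum_sum_type, Fintype.sum_sigma, Finset.sum_add_distrib]
  have e1 : ∑ v, D.delHalf U v = ∑ h : E × Bool, if D.he h ∈ U then 1 else 0 := by
    rw [← Finset.sum_fiberwise (s := Finset.univ) (g := D.t)]
    refine Finset.sum_congr rfl fun v _ => ?_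
    rw [delHalf, Finset.card_filter, Finset.sum_filter]
    refine Finset.sum_congr rfl fun h _ => ?_
    by_cases h1 : D.t h = v <;> simp [h1]
  have e2 : ∑ v, D.delOpt U v = ∑ v, ∑ p, if D.opt ⟨v, p⟩ ∈ U then 1 else 0 := by
    simp only [delOpt, Finset.card_filter]
  have e3 : ∑ v, D.delInn U v = ∑ v, ∑ p, if D.inn ⟨v, p⟩ ∈ U then 1 else 0 := by
    simp only [delInn, Finset.card_filter]
  rw [e1, e2, e3]
  change _ ≤ (∑ h, if D.he h ∈ U then 1 else 0) + ((∑ v, ∑ p, if D.opt ⟨v, p⟩ ∈ U then 1 else 0) +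
    ((∑ v, ∑ p, if D.inn ⟨v, p⟩ ∈ U then 1 else 0) + ∑ k, if D.aux k ∈ U then 1 else 0))
  omega

lemma sum_share_fiber (U : Finset D.Vert) (ε : ℝ) (v : V) :
    ∑ h with D.t h = v, D.share U ε h = ε * D.delHalf U v +
      (open scoped Classical in if D.IsT U v then (1 - ε) * (D.deg v - D.delHalf U v) else 0) := by
  classical
  have hsum := Finset.sum_filter_add_sum_filter_not (Finset.univ.filter fun h => D.t h = v)
    (fun h => D.he h ∈ U) (D.share U ε)
  rw [← hsum]
  have hcard := Finset.card_filter_add_card_filter_not (s := Finset.univ.filter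
      fun h => D.t h = v) (fun h => D.he h ∈ U)
  have e1 : ∑ h ∈ (Finset.univ.filter fun h => D.t h = v).filter (fun h => D.he h ∈ U),
      D.share U ε h = ε * D.delHalf U v := by
    rw [Finset.sum_congr rfl (g := fun _ => ε), Finset.sum_const, Finset.filter_filter, delHalf,
      nsmul_eq_mul, mul_comm]
    intro h hh
    simp only [Finset.mem_filter] at hh
    simp [share, hh.2]
  have e2 : ∑ h ∈ (Finset.univ.filter fun h => D.t h = v).filter (fun h => ¬ D.he h ∈ U),
      D.share U ε h = if D.IsT U v then (1 - ε) * (D.deg v - D.delHalf U v) else 0 := by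
    rw [Finset.sum_congr rfl (g := fun _ => if D.IsT U v then 1 - ε else 0), Finset.sum_const,
      nsmul_eq_mul]
    · have : (((Finset.univ.filter fun h => D.t h = v).filter (fun h => ¬ D.he h ∈ U)).card : ℝ) =
          D.deg v - D.delHalf U v := by
        rw [eq_sub_iff_add_eq, deg, delHalf, ← hcard, Finset.filter_filter, Finset.filter_filter]
        push_cast
        ring
      rw [this]
      split_ifs <;> ring
    · intro h hh
      simp only [Finset.mem_filter] at hh
      simp [share, hh.2, hh.1.2]
  rw [e1, e2]

lemma card_filter_fin_not (n : ℕ) (P : Fin n → Prop) [DecidablePred P] :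
    ((Finset.univ.filter fun i => ¬ P i).card : ℝ) = n - (Finset.univ.filter P).card := by
  have := Finset.card_filter_add_card_filter_not (s := (Finset.univ : Finset (Fin n))) P
  rw [Finset.card_univ, Fintype.card_fin] at this
  rw [eq_sub_iff_add_eq]
  exact_mod_cast (by omega)

lemma delHalf_eq_deg {U : Finset D.Vert} {v : V} (h : D.IsS U v) : D.delHalf U v = D.deg v := by
  rw [delHalf, deg]
  congr 1
  ext x
  simp only [Finset.mem_filter, Finset.mem_univ, true_and, and_iff_left_iff_imp]
  exact h.1 x

lemma delOpt_eq {U : Finset D.Vert} {v : V} (h : D.IsS U v) : D.delOpt U v = D.s v := by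
  rw [delOpt, Finset.filter_true_of_mem (fun p _ => h.2 ⟨v, p⟩ rfl)]
  simp

lemma delInn_eq {U : Finset D.Vert} {v : V} (h : D.IsT U v) : D.delInn U v = D.N v := by
  rw [delInn, Finset.filter_true_of_mem (fun p _ => h.2 ⟨v, p⟩ rfl)]
  simp

lemma sum_wt_opt (U : Finset D.Vert) (ε : ℝ) (v : V) :
    ∑ p, D.wt U ε (D.opt ⟨v, p⟩) =
      (open scoped Classical in
        if D.IsT U v then ((D.s v : ℝ) - D.delOpt U v) * D.delOpt U v else 0) := by
  classical
  have e : ∀ p, D.wt U ε (D.opt ⟨v, p⟩) = if ¬ D.opt ⟨v, p⟩ ∈ U then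
      (if D.IsT U v then (D.delOpt U v : ℝ) else 0) else 0 := by
    intro p
    simp only [wt, ite_not]
  simp only [e]
  rw [← Finset.sum_filter, Finset.sum_const, nsmul_eq_mul, card_filter_fin_not, delOpt]
  split_ifs <;> ring

lemma sum_wt_inn (U : Finset D.Vert) (ε : ℝ) (v : V) :
    ∑ i, D.wt U ε (D.inn ⟨v, i⟩) =
      (open scoped Classical in if D.IsS U v then (D.N v : ℝ) - D.delInn U v else 0) := by
  classical
  have e : ∀ p, D.wt U ε (D.inn ⟨v, p⟩) = if ¬ D.inn ⟨v, p⟩ ∈ U then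
      (if D.IsS U v then (1 : ℝ) else 0) else 0 := by
    intro p
    simp only [wt, ite_not]
  simp only [e]
  rw [← Finset.sum_filter, Finset.sum_const, nsmul_eq_mul, card_filter_fin_not, delInn]
  split_ifs <;> ring

/-- The deleted vertices pay for all weights, up to the losses at the single vertices. -/
theorem sum_wt_add_sum_vwt_le (U : Finset D.Vert) {ε : ℝ} (h0 : 0 ≤ ε) (h1 : ε ≤ 1)
    (hs : ∀ v, D.s v ≤ 2) :
    ∑ x, D.wt U ε x + ∑ v, D.vwt U ε v ≤ U.card + ∑ v, D.loss U ε v := by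
  classical
  have hU : ((∑ v, (D.delHalf U v + D.delOpt U v + D.delInn U v) : ℕ) : ℝ) ≤ U.card := by
    exact_mod_cast D.sum_del_le_card U
  refine le_trans ?_ (add_le_add_left hU _)
  have hhe := D.sum_wt_he_le U h0
  rw [← Finset.sum_fiberwise (s := Finset.univ) (g := D.t) (f := D.share U ε)] at hhe
  have hx : ∑ x, D.wt U ε x = ∑ h, D.wt U ε (D.he h) + (∑ v, ∑ p, D.wt U ε (D.opt ⟨v, p⟩) +
      ∑ v, ∑ i, D.wt U ε (D.inn ⟨v, i⟩)) := by
    simp [Fintype.sum_sum_type, Fintype.sum_sigma, wt]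
  rw [hx]
  push_cast
  have key : ∑ v, (∑ h with D.t h = v, D.share U ε h + ∑ p, D.wt U ε (D.opt ⟨v, p⟩) +
      ∑ i, D.wt U ε (D.inn ⟨v, i⟩) + D.vwt U ε v) ≤
      ∑ v, (((D.delHalf U v : ℝ) + D.delOpt U v + D.delInn U v) + D.loss U ε v) := by
    refine Finset.sum_le_sum fun v _ => ?_
    rw [sum_share_fiber, sum_wt_opt, sum_wt_inn]
    have hHn : (0 : ℝ) ≤ D.delHalf U v := by positivity
    by_cases hS : D.IsS U v
    · have hT : ¬ D.IsT U v := fun h => h.1 hS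
      have hC : ¬ D.IsC U v := fun h => h.1 hS
      have hI : (0 : ℝ) ≤ D.delInn U v := by positivity
      simp only [vwt, loss, if_pos hS, if_neg hT, if_neg hC, D.delHalf_eq_deg hS, D.delOpt_eq hS]
      linarith
    · by_cases hT : D.IsT U v
      · have hC : ¬ D.IsC U v := fun h => D.not_isT_of_isC h hT
        simp only [vwt, loss, if_neg hS, if_pos hT, if_neg hC, D.delInn_eq hT]
        have hop : ((D.s v : ℝ) - D.delOpt U v) * D.delOpt U v ≤ D.delOpt U v := by
          rcases Nat.eq_zero_or_pos (D.delOpt U v) with h | h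
          · simp [h]
          · have h2 : (1 : ℝ) ≤ D.delOpt U v := by exact_mod_cast h
            have h3 : (D.s v : ℝ) ≤ 2 := by exact_mod_cast hs v
            nlinarith
        nlinarith [mul_nonneg (sub_nonneg.2 h1) hHn]
      · have hC := (D.isT_or_isC hS).resolve_left hT
        simp only [vwt, loss, if_neg hS, if_neg hT, if_pos hC]
        linarith
  simp only [Finset.sum_add_distrib] at key ⊢
  linarith

end GadgetData

/-! ### The weight of an odd component -/

/-- A component is contained in every set that is closed under adjacency in `G - U` and contains one
of its vertices. -/
lemma SimpleGraph.IsOddComponentOff.subset {V : Type*} {G : SimpleGraph V} {U W : Finset V}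
    (hW : G.IsOddComponentOff U W) {x : V} (hx : x ∈ W) (A : Set V) (hxA : x ∈ A)
    (hA : ∀ a ∈ A, ∀ b, G.AdjOff U a b → b ∈ A) : ∀ y ∈ W, y ∈ A := by
  intro y hy
  have key := hW.connected x hx y hy
  clear hy
  induction key with
  | refl => exact hxA
  | tail _ hbc ih => exact hA _ ih _ hbc

namespace GadgetData

variable {V E : Type*} (D : GadgetData V E)

/-- `W` contains a vertex of the clique formed by the auxiliary vertices and the optional vertices
outside `V₀`. -/
def MeetsClique (W : Finset D.Vert) : Prop :=
  (∃ p, D.opt p ∈ W ∧ p.1 ∉ D.V₀) ∨ ∃ k, D.aux k ∈ W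

/-- `W` contains the surviving part of the gadget at `v`. -/
def Owns (U W : Finset D.Vert) (v : V) : Prop :=
  D.IsC U v ∧ ∃ i : Σ v, Fin (D.N v), i.1 = v ∧ D.inn i ∈ W

/-- A gadget vertex `x` is attached to `v` if it belongs to the gadget at `v`, or if it is a
half-edge that lost all inner vertices at its end and whose other half survives at `v`. -/
def Attached (U : Finset D.Vert) (v : V) : D.Vert → Prop
  | .inl h => (¬ D.IsT U (D.t h) ∧ D.t h = v) ∨
      (D.IsT U (D.t h) ∧ D.he (flipHalf h) ∉ U ∧ D.t (flipHalf h) = v)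
  | .inr (.inl p) => p.1 = v
  | .inr (.inr (.inl i)) => i.1 = v
  | .inr (.inr (.inr _)) => False

/-- Adjacency within `X` in the multigraph. -/
def AdjIn (X : Finset V) (a b : V) : Prop :=
  a ∈ X ∧ b ∈ X ∧ ∃ h, D.t h = a ∧ D.t (flipHalf h) = b

section
variable {D} {U W : Finset D.Vert}

lemma owns_of_he (hW : D.graph.IsOddComponentOff U W) {h : E × Bool} (hh : D.he h ∈ W)
    (hC : D.IsC U (D.t h)) : D.Owns U W (D.t h) := by
  obtain ⟨i, hi, hiU⟩ := hC.2
  exact ⟨hC, i, hi, hW.closed _ hh (D.inn i) hiU hi.symm⟩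

lemma owns_of_opt (hW : D.graph.IsOddComponentOff U W) {p : Σ v, Fin (D.s v)} (hp : D.opt p ∈ W)
    (hC : D.IsC U p.1) : D.Owns U W p.1 := by
  obtain ⟨i, hi, hiU⟩ := hC.2
  exact ⟨hC, i, hi, hW.closed _ hp (D.inn i) hiU hi.symm⟩

lemma Owns.he_mem (hW : D.graph.IsOddComponentOff U W) {v : V} (hv : D.Owns U W v) {h : E × Bool}
    (hh : D.t h = v) (hU : D.he h ∉ U) : D.he h ∈ W := by
  obtain ⟨-, i, hi, hiW⟩ := hv
  exact hW.closed (D.inn i) hiW _ hU (hh.trans hi.symm)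

lemma Owns.opt_mem (hW : D.graph.IsOddComponentOff U W) {v : V} (hv : D.Owns U W v)
    {p : Σ v, Fin (D.s v)} (hp : p.1 = v) (hU : D.opt p ∉ U) : D.opt p ∈ W := by
  obtain ⟨-, i, hi, hiW⟩ := hv
  exact hW.closed (D.inn i) hiW _ hU (hp.trans hi.symm)

lemma Owns.inn_mem (hW : D.graph.IsOddComponentOff U W) {v : V} (hv : D.Owns U W v)
    {i : Σ v, Fin (D.N v)} (hi : i.1 = v) (hU : D.inn i ∉ U) : D.inn i ∈ W := by
  have hS := hv.1.1
  unfold IsS at hS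
  rw [not_and_or] at hS
  push Not at hS
  rcases hS with ⟨h, hh, hhU⟩ | ⟨p, hp, hpU⟩
  · exact hW.closed _ (hv.he_mem hW hh hhU) (D.inn i) hU (hh.trans hi.symm)
  · exact hW.closed _ (hv.opt_mem hW hp hpU) (D.inn i) hU (hp.trans hi.symm)

variable [Fintype V] [Fintype E] [DecidableEq V] [DecidableEq E] {ε : ℝ}

open scoped Classical in
variable (U W) in
/-- The vertices whose gadgets survive in `W`. -/
noncomputable def owned : Finset V := Finset.univ.filter (D.Owns U W)

@[simp] lemma mem_owned {v : V} : v ∈ D.owned U W ↔ D.Owns U W v := by simp [owned]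

variable (U ε W) in
/-- The total weight of a component `W`. -/
noncomputable def compWt : ℝ := ∑ x ∈ W, D.wt U ε x + ∑ v ∈ D.owned U W, D.vwt U ε v

lemma wt_le_compWt (h0 : 0 ≤ ε) (h1 : ε ≤ 1) {x : D.Vert} (hx : x ∈ W) :
    D.wt U ε x ≤ D.compWt U W ε := by
  have e1 := Finset.single_le_sum (fun y _ => D.wt_nonneg U h0 h1 y) hx
  have e2 := Finset.sum_nonneg (s := D.owned U W) (fun y _ => D.vwt_nonneg U h1 y)
  unfold compWt
  linarith

lemma vwt_le_compWt (h0 : 0 ≤ ε) (h1 : ε ≤ 1) {v : V} (hv : v ∈ D.owned U W) :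
    D.vwt U ε v ≤ D.compWt U W ε := by
  have e1 := Finset.single_le_sum (fun y _ => D.vwt_nonneg U h1 y) hv
  have e2 := Finset.sum_nonneg (s := W) (fun y _ => D.wt_nonneg U h0 h1 y)
  unfold compWt
  linarith

/-- A surviving optional vertex at a vertex of `V₀` without inner vertices forms a component with
its surviving siblings. As their total number is even, some sibling has been deleted. -/
lemma one_le_wt_opt (hs : ∀ v ∈ D.V₀, Even (D.s v)) (hW : D.graph.IsOddComponentOff U W)
    {p : Σ v, Fin (D.s v)} (hp : D.opt p ∈ W) (hpV : p.1 ∈ D.V₀) (hT : D.IsT U p.1) :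
    1 ≤ D.wt U ε (D.opt p) := by
  have hpU : D.opt p ∉ U := Finset.disjoint_left.1 hW.disjoint hp
  have hsub := hW.subset hp {x | ∃ q, x = D.opt q ∧ q.1 = p.1} ⟨p, rfl, rfl⟩ (by
    rintro _ ⟨q, rfl, hq⟩ b ⟨hab, -, hbU⟩
    rcases b with h | q' | i | k
    · exact hab.elim
    · rcases hab.2 with h | h
      · exact ⟨q', rfl, h.symm.trans hq⟩
      · rw [hq] at h
        exact absurd hpV h.1
    · exact absurd (hT.2 i ((show q.1 = i.1 from hab).symm.trans hq)) hbU
    · rw [← hq] at hpV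
      exact absurd hpV hab)
  have hcard : W.card =
      (Finset.univ.filter fun q : Fin (D.s p.1) => ¬ D.opt ⟨p.1, q⟩ ∈ U).card := by
    symm
    apply Finset.card_bij (fun q _ => D.opt ⟨p.1, q⟩)
    · intro q hq
      simp only [Finset.mem_filter, Finset.mem_univ, true_and] at hq
      by_cases hqp : (⟨p.1, q⟩ : Σ v, Fin (D.s v)) = p
      · rw [hqp]; exact hp
      · exact hW.closed _ hp _ hq ⟨fun h => hqp h.symm, .inl rfl⟩
    · intro q _ q' _ h
      simpa using h
    · intro x hx
      obtain ⟨⟨v, q⟩, rfl, hq⟩ := hsub x hx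
      simp only at hq
      subst hq
      exact ⟨q, by simpa using Finset.disjoint_left.1 hW.disjoint hx, rfl⟩
  have hodd := hW.odd_card
  have htot := Finset.card_filter_add_card_filter_not (s := Finset.univ)
    (fun q : Fin (D.s p.1) => D.opt ⟨p.1, q⟩ ∈ U)
  rw [← hcard, Finset.card_univ, Fintype.card_fin] at htot
  have hev := hs p.1 hpV
  have hpos : 1 ≤ D.delOpt U p.1 := by
    by_contra hlt
    have : D.delOpt U p.1 = 0 := by omega
    unfold delOpt at this
    rw [this, zero_add] at htot
    rw [htot] at hodd
    exact Nat.not_even_iff_odd.2 hodd hev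
  simp only [wt, if_neg hpU, if_pos hT]
  exact_mod_cast hpos

/-- A component of weight less than `1` consists of vertices attached to its gadgets. -/
lemma exists_attached (h0 : 0 ≤ ε) (h1 : ε ≤ 1) (hs : ∀ v ∈ D.V₀, Even (D.s v))
    (hW : D.graph.IsOddComponentOff U W) (hK : ¬ D.MeetsClique W) (hlt : D.compWt U W ε < 1)
    {x : D.Vert} (hx : x ∈ W) : ∃ v, D.Owns U W v ∧ D.Attached U v x := by
  have hxU : x ∉ U := Finset.disjoint_left.1 hW.disjoint hx
  have hwt : D.wt U ε x < 1 := (wt_le_compWt h0 h1 hx).trans_lt hlt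
  rcases x with h | p | i | k
  · have hS : ¬ D.IsS U (D.t h) := fun hS => hxU (hS.1 h rfl)
    rcases D.isT_or_isC hS with hT | hC
    · by_cases hf : D.he (flipHalf h) ∈ U
      · simp only [wt, share, if_neg hxU, if_pos hT, if_pos hf] at hwt
        linarith
      · have hfW : D.he (flipHalf h) ∈ W := hW.closed _ hx _ hf rfl
        have hS' : ¬ D.IsS U (D.t (flipHalf h)) := fun hS => hf (hS.1 _ rfl)
        rcases D.isT_or_isC hS' with hT' | hC'
        · -- the two halves of an edge would be a component of order two
          exfalso
          have hsub := hW.subset hx {D.he h, D.he (flipHalf h)} (by simp) (by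
            rintro a ha b ⟨hab, -, hbU⟩
            have key : ∀ g, D.IsT U (D.t g) → D.graph.Adj (D.he g) b → b = D.he (flipHalf g) := by
              intro g hg hgb
              rcases b with h' | q' | j | k
              · rw [show h' = flipHalf g from hgb]
              · exact hgb.elim
              · exact absurd (hg.2 j (show D.t g = j.1 from hgb).symm) hbU
              · exact hgb.elim
            rcases ha with rfl | rfl
            · exact .inr (key h hT hab)
            · have := key _ hT' hab
              rw [flipHalf_flipHalf] at this
              exact .inl this)
          have hWeq : W = {D.he h, D.he (flipHalf h)} := by
            ext y
            constructor
            · intro hy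
              simpa using hsub y hy
            · intro hy
              simp only [Finset.mem_insert, Finset.mem_singleton] at hy
              rcases hy with rfl | rfl
              · exact hx
              · exact hfW
          have hodd := hW.odd_card
          rw [hWeq, Finset.card_pair] at hodd
          · exact absurd hodd (by decide)
          · intro h'
            simp only [Sum.inl.injEq] at h'
            exact flipHalf_ne h h'.symm
        · exact ⟨_, owns_of_he hW hfW hC', .inr ⟨hT, hf, rfl⟩⟩
    · exact ⟨_, owns_of_he hW hx hC, .inl ⟨D.not_isT_of_isC hC, rfl⟩⟩
  · have hpV : p.1 ∈ D.V₀ := by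
      by_contra hpV
      exact hK (.inl ⟨p, hx, hpV⟩)
    have hS : ¬ D.IsS U p.1 := fun hS => hxU (hS.2 p rfl)
    rcases D.isT_or_isC hS with hT | hC
    · exact absurd (one_le_wt_opt (ε := ε) hs hW hx hpV hT) (not_le.2 hwt)
    · exact ⟨_, owns_of_opt hW hx hC, rfl⟩
  · by_cases hS : D.IsS U i.1
    · simp only [wt, if_neg hxU, if_pos hS] at hwt
      linarith
    · rcases D.isT_or_isC hS with hT | hC
      · exact absurd (hT.2 i rfl) hxU
      · exact ⟨i.1, ⟨hC, i, rfl, hx⟩, rfl⟩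
  · exact absurd (.inr ⟨k, hx⟩) hK

lemma mul_delHalf_nonneg (h1 : ε ≤ 1) (v : V) : 0 ≤ (1 - ε) * D.delHalf U v :=
  mul_nonneg (by linarith) (by positivity)

/-- In a component of weight less than `1` only half-edges are missing from its gadgets. -/
lemma Owns.del_eq_zero (h0 : 0 ≤ ε) (h1 : ε ≤ 1) (hlt : D.compWt U W ε < 1) {v : V}
    (hv : D.Owns U W v) : D.delOpt U v = 0 ∧ D.delInn U v = 0 := by
  have hw : D.vwt U ε v < 1 := (vwt_le_compWt h0 h1 (mem_owned.2 hv)).trans_lt hlt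
  simp only [vwt, if_pos hv.1] at hw
  have := D.mul_delHalf_nonneg (U := U) h1 v
  have h2 : ((D.delOpt U v + D.delInn U v : ℕ) : ℝ) < 1 := by push_cast; linarith
  have h3 : D.delOpt U v + D.delInn U v < 1 := by exact_mod_cast h2
  omega

lemma opt_notMem_of_delOpt {p : Σ v, Fin (D.s v)} (h : D.delOpt U p.1 = 0) : D.opt p ∉ U := by
  rw [delOpt, Finset.card_eq_zero, Finset.filter_eq_empty_iff] at h
  exact h (Finset.mem_univ p.2)

lemma inn_notMem_of_delInn {p : Σ v, Fin (D.N v)} (h : D.delInn U p.1 = 0) : D.inn p ∉ U := by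
  rw [delInn, Finset.card_eq_zero, Finset.filter_eq_empty_iff] at h
  exact h (Finset.mem_univ p.2)

lemma Owns.mem_V₀ (h0 : 0 ≤ ε) (h1 : ε ≤ 1) (hs1 : ∀ v ∉ D.V₀, 0 < D.s v)
    (hW : D.graph.IsOddComponentOff U W) (hK : ¬ D.MeetsClique W) (hlt : D.compWt U W ε < 1) {v : V}
    (hv : D.Owns U W v) : v ∈ D.V₀ := by
  by_contra hvV
  have hU := opt_notMem_of_delOpt (p := ⟨v, ⟨0, hs1 v hvV⟩⟩) (hv.del_eq_zero h0 h1 hlt).1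
  exact hK (.inl ⟨_, hv.opt_mem hW rfl hU, hvV⟩)

/-- The vertices whose gadgets survive in a component of weight less than `1` induce a connected
subgraph of the multigraph. -/
lemma owned_connected (h0 : 0 ≤ ε) (h1 : ε ≤ 1) (hs : ∀ v ∈ D.V₀, Even (D.s v))
    (hW : D.graph.IsOddComponentOff U W) (hK : ¬ D.MeetsClique W) (hlt : D.compWt U W ε < 1)
    {u v : V} (hu : u ∈ D.owned U W) (hv : v ∈ D.owned U W) :
    Relation.ReflTransGen (D.AdjIn (D.owned U W)) u v := by
  obtain ⟨-, i, hi, hiW⟩ := mem_owned.1 hu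
  obtain ⟨-, j, hj, hjW⟩ := mem_owned.1 hv
  have step : ∀ x ∈ W, ∀ y ∈ W, D.graph.Adj x y → ∀ a b, D.Owns U W a → D.Owns U W b →
      D.Attached U a x → D.Attached U b y → a = b ∨ D.AdjIn (D.owned U W) a b := by
    intro x hx y hy hxy a b ha hb hax hby
    have hxU : x ∉ U := Finset.disjoint_left.1 hW.disjoint hx
    have hyU : y ∉ U := Finset.disjoint_left.1 hW.disjoint hy
    rcases x with h | p | i | k <;> rcases y with h' | q | j | l
    · obtain rfl : h' = flipHalf h := hxy
      simp only [Attached, flipHalf_flipHalf] at hax hby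
      rcases hax with ⟨hT, rfl⟩ | ⟨hT, -, rfl⟩ <;> rcases hby with ⟨hT', rfl⟩ | ⟨hT', -, rfl⟩
      · exact .inr ⟨mem_owned.2 ha, mem_owned.2 hb, h, rfl, rfl⟩
      · exact .inl rfl
      · exact .inl rfl
      · exact absurd hT' (D.not_isT_of_isC ha.1)
    · exact hxy.elim
    · have hT : ¬ D.IsT U (D.t h) := fun hT => hyU (hT.2 j (show D.t h = j.1 from hxy).symm)
      simp only [Attached, hT, not_false_iff, true_and, false_and, or_false] at hax hby
      exact .inl (by rw [← hax, ← hby]; exact hxy)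
    · exact hxy.elim
    · exact hxy.elim
    · rcases hxy.2 with h | h
      · exact .inl (by rw [← show p.1 = a from hax, ← show q.1 = b from hby]; exact h)
      · exact absurd (.inl ⟨p, hx, h.1⟩) hK
    · exact .inl (by rw [← show p.1 = a from hax, ← show j.1 = b from hby]; exact hxy)
    · exact hby.elim
    · have hT : ¬ D.IsT U (D.t h') := fun hT => hxU (hT.2 i (show D.t h' = i.1 from hxy).symm)
      simp only [Attached, hT, not_false_iff, true_and, false_and, or_false] at hax hby
      exact .inl (by rw [← hax, ← hby]; exact (show D.t h' = i.1 from hxy).symm)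
    · exact .inl (by
        rw [← show i.1 = a from hax, ← show q.1 = b from hby]
        exact (show q.1 = i.1 from hxy).symm)
    · exact hxy.elim
    · exact hby.elim
    all_goals exact hax.elim
  have key : ∀ y, Relation.ReflTransGen (D.graph.AdjOff U) (D.inn i) y → y ∈ W ∧
      ∀ b, D.Owns U W b → D.Attached U b y →
        Relation.ReflTransGen (D.AdjIn (D.owned U W)) u b := by
    intro y hy
    induction hy with
    | refl =>
      refine ⟨hiW, fun b _ hb => ?_⟩
      rw [← show i.1 = b from hb, hi]
    | @tail x y _ hxy ih =>
      have hyW := hW.closed _ ih.1 _ hxy.2.2 hxy.1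
      refine ⟨hyW, fun b hb hby => ?_⟩
      obtain ⟨a, ha, hax⟩ := exists_attached h0 h1 hs hW hK hlt ih.1
      have h2 := ih.2 a ha hax
      rcases step _ ih.1 _ hyW hxy.1 a b ha hb hax hby with rfl | h3
      · exact h2
      · exact h2.tail h3
  exact (key _ (hW.connected _ hiW _ hjW)).2 v (mem_owned.1 hv) hj

end

end GadgetData

/-! ### Boundary counts and the factor theorem -/

namespace GadgetData

variable {V E : Type*} [Fintype V] [Fintype E] [DecidableEq V] [DecidableEq E]
  {D : GadgetData V E}

variable (D) in
/-- The number of edges with exactly one end in `X`, counted by their half-edges in `X`. -/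
def cut (X : Finset V) : ℕ :=
  (Finset.univ.filter fun h => D.t h ∈ X ∧ D.t (flipHalf h) ∉ X).card

variable (D) in
/-- The number of surviving half-edges in `X` whose other half is deleted. -/
def cutS (U : Finset D.Vert) (X : Finset V) : ℕ :=
  (Finset.univ.filter fun h => D.t h ∈ X ∧ D.he h ∉ U ∧ D.he (flipHalf h) ∈ U).card

variable (D) in
/-- The number of deleted half-edges in `X`. -/
def cutDel (U : Finset D.Vert) (X : Finset V) : ℕ :=
  (Finset.univ.filter fun h => D.t h ∈ X ∧ D.he h ∈ U).card

open scoped Classical in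
variable (D) in
/-- The number of surviving edges between `X` and a vertex that lost all its inner vertices, counted
by their half-edges outside `X`. -/
noncomputable def cutT (U : Finset D.Vert) (X : Finset V) : ℕ :=
  (Finset.univ.filter fun h => D.IsT U (D.t h) ∧ D.he h ∉ U ∧ D.he (flipHalf h) ∉ U ∧
    D.t (flipHalf h) ∈ X).card

variable {U W : Finset D.Vert} {ε : ℝ}

lemma sum_delHalf (U : Finset D.Vert) (X : Finset V) :
    ∑ v ∈ X, D.delHalf U v = D.cutDel U X := by
  unfold cutDel delHalf
  rw [Finset.card_eq_sum_card_fiberwise (f := D.t) (t := X)]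
  · refine Finset.sum_congr rfl fun v hv => ?_
    congr 1
    ext h
    simp only [Finset.mem_filter, Finset.mem_univ, true_and]
    constructor
    · rintro ⟨rfl, h2⟩
      exact ⟨⟨hv, h2⟩, rfl⟩
    · rintro ⟨⟨-, h2⟩, rfl⟩
      exact ⟨rfl, h2⟩
  · intro h hh
    simp only [Finset.coe_filter, Finset.mem_univ, true_and, Set.mem_ofPred_eq] at hh
    exact hh.1

lemma sum_deg (X : Finset V) :
    ∑ v ∈ X, D.deg v = (Finset.univ.filter fun h => D.t h ∈ X).card := by
  unfold deg
  rw [Finset.card_eq_sum_card_fiberwise (f := D.t) (t := X)]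
  · refine Finset.sum_congr rfl fun v hv => ?_
    congr 1
    ext h
    simp only [Finset.mem_filter, Finset.mem_univ, true_and]
    constructor
    · rintro rfl
      exact ⟨hv, rfl⟩
    · rintro ⟨-, rfl⟩
      rfl
  · intro h hh
    simpa using hh

/-- A boundary edge contributes `ε` or `1 - ε` to the weight of the component, depending on which
side of its boundary was deleted. -/
lemma le_compWt (h0 : 0 ≤ ε) (h1 : ε ≤ 1) (hW : D.graph.IsOddComponentOff U W) :
    ε * D.cutS U (D.owned U W) +
      (1 - ε) * (D.cutDel U (D.owned U W) + D.cutT U (D.owned U W)) ≤ D.compWt U W ε := by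
  classical
  set X := D.owned U W with hX
  have e1 : (1 - ε) * D.cutDel U X ≤ ∑ v ∈ X, D.vwt U ε v := by
    rw [← sum_delHalf, Nat.cast_sum, Finset.mul_sum]
    refine Finset.sum_le_sum fun v hv => ?_
    simp only [vwt, if_pos (mem_owned.1 hv).1]
    have : (0 : ℝ) ≤ D.delOpt U v := by positivity
    have : (0 : ℝ) ≤ D.delInn U v := by positivity
    linarith
  have e2 : ∑ h, (if D.he h ∈ W then D.wt U ε (D.he h) else 0) ≤ ∑ x ∈ W, D.wt U ε x := by
    have : ∑ x ∈ W, D.wt U ε x = ∑ x, if x ∈ W then D.wt U ε x else 0 := by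
      rw [Finset.sum_ite_mem, Finset.univ_inter]
    rw [this, Fintype.sum_sum_type]
    refine le_add_of_nonneg_right (Finset.sum_nonneg fun x _ => ?_)
    split_ifs
    · exact D.wt_nonneg U h0 h1 _
    · exact le_rfl
  have e3 : ε * D.cutS U X + (1 - ε) * D.cutT U X ≤
      ∑ h, (if D.he h ∈ W then D.wt U ε (D.he h) else 0) := by
    unfold cutS cutT
    rw [Finset.card_filter, Finset.card_filter]
    push_cast
    rw [Finset.mul_sum, Finset.mul_sum, ← Finset.sum_add_distrib]
    refine Finset.sum_le_sum fun h _ => ?_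
    by_cases hc : D.IsT U (D.t h) ∧ D.he h ∉ U ∧ D.he (flipHalf h) ∉ U ∧ D.t (flipHalf h) ∈ X
    · have hcc := hc
      obtain ⟨hT, hU, hfU, hfX⟩ := hcc
      have hfW := (mem_owned.1 hfX).he_mem hW rfl hfU
      have hhW : D.he h ∈ W := hW.closed _ hfW _ hU (flipHalf_flipHalf h).symm
      have ha : ¬ (D.t h ∈ X ∧ D.he h ∉ U ∧ D.he (flipHalf h) ∈ U) := fun h' => hfU h'.2.2
      rw [if_pos hc, if_neg ha, if_pos hhW]
      simp [wt, share, hU, hT, hfU]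
    · rw [if_neg hc]
      by_cases ha : D.t h ∈ X ∧ D.he h ∉ U ∧ D.he (flipHalf h) ∈ U
      · have hcc := ha
        obtain ⟨hX', hU, hfU⟩ := hcc
        have hhW := (mem_owned.1 hX').he_mem hW rfl hU
        rw [if_pos ha, if_pos hhW]
        have hT := D.not_isT_of_isC (mem_owned.1 hX').1
        simp [wt, share, hU, hT, hfU]
      · rw [if_neg ha]
        simp only [mul_zero, add_zero]
        split_ifs
        · exact D.wt_nonneg U h0 h1 _
        · exact le_rfl
  unfold compWt
  rw [← hX]
  linarith

/-- The order of a component of weight less than `1` determines a parity condition on the vertices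
whose gadgets it contains. -/
lemma odd_sum_add_cut (h0 : 0 ≤ ε) (h1 : ε ≤ 1) (hs : ∀ v ∈ D.V₀, Even (D.s v))
    (hs1 : ∀ v ∉ D.V₀, 0 < D.s v)
    (hW : D.graph.IsOddComponentOff U W) (hK : ¬ D.MeetsClique W) (hlt : D.compWt U W ε < 1) :
    Odd (∑ v ∈ D.owned U W, (D.deg v + D.N v) +
      (D.cutDel U (D.owned U W) + D.cutT U (D.owned U W))) := by
  classical
  set X := D.owned U W with hX
  have hdel : ∀ v ∈ X, D.delOpt U v = 0 ∧ D.delInn U v = 0 := fun v hv =>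
    (mem_owned.1 hv).del_eq_zero h0 h1 hlt
  have hnU : ∀ x ∈ W, x ∉ U := fun x hx => Finset.disjoint_left.1 hW.disjoint hx
  have mem_he : ∀ h, D.he h ∈ W ↔ ((D.t h ∈ X ∧ D.he h ∉ U) ∨ (D.IsT U (D.t h) ∧ D.he h ∉ U ∧
      D.he (flipHalf h) ∉ U ∧ D.t (flipHalf h) ∈ X)) := by
    intro h
    constructor
    · intro hh
      obtain ⟨v, hv, hvh⟩ := exists_attached h0 h1 hs hW hK hlt hh
      rcases hvh with ⟨-, rfl⟩ | ⟨hT, hf, rfl⟩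
      · exact .inl ⟨mem_owned.2 hv, hnU _ hh⟩
      · exact .inr ⟨hT, hnU _ hh, hf, mem_owned.2 hv⟩
    · rintro (⟨hv, hU⟩ | ⟨-, hU, hf, hv⟩)
      · exact (mem_owned.1 hv).he_mem hW rfl hU
      · exact hW.closed _ ((mem_owned.1 hv).he_mem hW rfl hf) _ hU (flipHalf_flipHalf h).symm
  have mem_opt : ∀ p, D.opt p ∈ W ↔ p.1 ∈ X := by
    intro p
    constructor
    · intro hp
      obtain ⟨v, hv, hvp⟩ := exists_attached h0 h1 hs hW hK hlt hp
      rw [show p.1 = v from hvp]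
      exact mem_owned.2 hv
    · intro hp
      exact (mem_owned.1 hp).opt_mem hW rfl (opt_notMem_of_delOpt (hdel _ hp).1)
  have mem_inn : ∀ p, D.inn p ∈ W ↔ p.1 ∈ X := by
    intro p
    constructor
    · intro hp
      obtain ⟨v, hv, hvp⟩ := exists_attached h0 h1 hs hW hK hlt hp
      rw [show p.1 = v from hvp]
      exact mem_owned.2 hv
    · intro hp
      exact (mem_owned.1 hp).inn_mem hW rfl (inn_notMem_of_delInn (hdel _ hp).2)
  have mem_aux : ∀ k, D.aux k ∉ W := fun k hk => hK (.inr ⟨k, hk⟩)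
  have hcard : W.card = ((Finset.univ.filter fun h => D.t h ∈ X ∧ D.he h ∉ U).card + D.cutT U X) +
      (∑ v ∈ X, D.s v + ∑ v ∈ X, D.N v) := by
    have e0 : W.card = ∑ x : D.Vert, if x ∈ W then 1 else 0 := by simp
    rw [e0, Fintype.sum_sum_type, Fintype.sum_sum_type, Fintype.sum_sum_type, Fintype.sum_sigma,
      Fintype.sum_sigma]
    have e1 : ∀ n : V → ℕ, ∑ v, ∑ _p : Fin (n v), (if v ∈ X then 1 else 0) = ∑ v ∈ X, n v := by
      intro n
      simp [Finset.sum_ite_mem]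
    have e2 : ∑ v, ∑ p : Fin (D.s v), (if D.opt ⟨v, p⟩ ∈ W then 1 else 0) = ∑ v ∈ X, D.s v := by
      simp only [mem_opt, e1]
    have e3 : ∑ v, ∑ p : Fin (D.N v), (if D.inn ⟨v, p⟩ ∈ W then 1 else 0) = ∑ v ∈ X, D.N v := by
      simp only [mem_inn, e1]
    have e4 : ∑ k, (if D.aux k ∈ W then 1 else 0) = 0 := by
      simp only [mem_aux, if_false, Finset.sum_const_zero]
    have e5 : ∑ h, (if D.he h ∈ W then 1 else 0) =
        (Finset.univ.filter fun h => D.t h ∈ X ∧ D.he h ∉ U).card + D.cutT U X := by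
      unfold cutT
      rw [← Finset.card_filter, ← Finset.card_union_of_disjoint, ← Finset.filter_or]
      · simp only [mem_he]
      · rw [Finset.disjoint_filter]
        rintro h - ⟨hX', -⟩ ⟨hT, -⟩
        exact D.not_isT_of_isC (mem_owned.1 hX').1 hT
    change (∑ h, if D.he h ∈ W then 1 else 0) +
      ((∑ v, ∑ p, if D.opt ⟨v, p⟩ ∈ W then 1 else 0) +
      ((∑ v, ∑ p, if D.inn ⟨v, p⟩ ∈ W then 1 else 0) + ∑ k, if D.aux k ∈ W then 1 else 0)) = _
    rw [e2, e3, e4, e5, add_zero]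
  have hdeg : ∑ v ∈ X, D.deg v =
      (Finset.univ.filter fun h => D.t h ∈ X ∧ D.he h ∉ U).card + D.cutDel U X := by
    rw [sum_deg, ← Finset.card_filter_add_card_filter_not (fun h => D.he h ∈ U),
      Finset.filter_filter, Finset.filter_filter, add_comm]
    rfl
  have hsev : Even (∑ v ∈ X, D.s v) := Finset.even_sum _ fun v hv =>
    hs v ((mem_owned.1 hv).mem_V₀ h0 h1 hs1 hW hK hlt)
  have hodd := hW.odd_card
  rw [hcard] at hodd
  rw [Finset.sum_add_distrib, hdeg]
  rw [Nat.odd_iff] at hodd ⊢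
  rw [Nat.even_iff] at hsev
  omega

/-- The far end of a surviving edge leaving a component of weight less than `1`. -/
lemma isT_of_notMem_owned (hW : D.graph.IsOddComponentOff U W) {h : E × Bool}
    (hX : D.t h ∈ D.owned U W) (hU : D.he h ∉ U) (hf : D.he (flipHalf h) ∉ U)
    (hfX : D.t (flipHalf h) ∉ D.owned U W) : D.IsT U (D.t (flipHalf h)) := by
  have hS : ¬ D.IsS U (D.t (flipHalf h)) := fun hS => hf (hS.1 _ rfl)
  refine (D.isT_or_isC hS).resolve_right fun hC => hfX (mem_owned.2 (owns_of_he hW ?_ hC))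
  exact hW.closed _ ((mem_owned.1 hX).he_mem hW rfl hU) _ hf rfl

lemma cut_le_cutS (hW : D.graph.IsOddComponentOff U W)
    (hb : D.cutDel U (D.owned U W) + D.cutT U (D.owned U W) = 0) :
    D.cut (D.owned U W) ≤ D.cutS U (D.owned U W) := by
  classical
  obtain ⟨hb1, hb2⟩ := Nat.add_eq_zero_iff.1 hb
  unfold cutDel at hb1
  unfold cutT at hb2
  rw [Finset.card_eq_zero, Finset.filter_eq_empty_iff] at hb1 hb2
  refine Finset.card_le_card fun h hh => ?_
  simp only [Finset.mem_filter, Finset.mem_univ, true_and] at hh ⊢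
  have hU : D.he h ∉ U := fun hU => hb1 (Finset.mem_univ h) ⟨hh.1, hU⟩
  refine ⟨hh.1, hU, ?_⟩
  by_contra hf
  refine hb2 (Finset.mem_univ (flipHalf h)) ⟨isT_of_notMem_owned hW hh.1 hU hf hh.2, hf, ?_⟩
  rw [flipHalf_flipHalf]
  exact ⟨hU, hh.1⟩

lemma even_card_of_flip (s : Finset (E × Bool)) (hs : ∀ h ∈ s, flipHalf h ∈ s) : Even s.card := by
  rw [even_iff_two_dvd, ← ZMod.natCast_eq_zero_iff, Finset.card_eq_sum_ones, Nat.cast_sum]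
  refine Finset.sum_involution (fun p _ => flipHalf p) ?_ ?_ ?_ ?_
  · intro _ _; decide
  · intro h _ _
    exact flipHalf_ne h
  · exact hs
  · intro h _
    exact flipHalf_flipHalf h

lemma exists_cutDel_add_cutT_eq (hW : D.graph.IsOddComponentOff U W)
    (ha : D.cutS U (D.owned U W) = 0) :
    ∃ c, Even c ∧
      D.cutDel U (D.owned U W) + D.cutT U (D.owned U W) = D.cut (D.owned U W) + c := by
  classical
  -- the excess counts the deleted half-edges inside `X`, which come in pairs as `cutS` vanishes
  set X := D.owned U W with hX
  unfold cutS at ha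
  rw [Finset.card_eq_zero, Finset.filter_eq_empty_iff] at ha
  have ha' : ∀ h, D.t h ∈ X → D.he h ∉ U → D.he (flipHalf h) ∉ U := fun h h2 h3 h4 =>
    ha (Finset.mem_univ h) ⟨h2, h3, h4⟩
  refine ⟨(Finset.univ.filter fun h => (D.t h ∈ X ∧ D.he h ∈ U) ∧ D.t (flipHalf h) ∈ X).card,
    ?_, ?_⟩
  · apply even_card_of_flip
    intro h hh
    simp only [Finset.mem_filter, Finset.mem_univ, true_and, flipHalf_flipHalf] at hh ⊢
    refine ⟨⟨hh.2, ?_⟩, hh.1.1⟩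
    by_contra hf
    have := ha' _ hh.2 hf
    rw [flipHalf_flipHalf] at this
    exact this hh.1.2
  · have e1 : D.cutDel U X =
        (Finset.univ.filter fun h => (D.t h ∈ X ∧ D.he h ∈ U) ∧ D.t (flipHalf h) ∈ X).card +
        (Finset.univ.filter fun h => (D.t h ∈ X ∧ D.he h ∈ U) ∧ ¬ D.t (flipHalf h) ∈ X).card := by
      unfold cutDel
      rw [← Finset.card_filter_add_card_filter_not (fun h => D.t (flipHalf h) ∈ X),
        Finset.filter_filter, Finset.filter_filter]
    have e2 : D.cut X =
        (Finset.univ.filter fun h => (D.t h ∈ X ∧ D.t (flipHalf h) ∉ X) ∧ D.he h ∈ U).card +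
        (Finset.univ.filter fun h => (D.t h ∈ X ∧ D.t (flipHalf h) ∉ X) ∧ ¬ D.he h ∈ U).card := by
      unfold cut
      rw [← Finset.card_filter_add_card_filter_not (fun h => D.he h ∈ U),
        Finset.filter_filter, Finset.filter_filter]
    have e3 : D.cutT U X =
        (Finset.univ.filter fun h => (D.t h ∈ X ∧ D.t (flipHalf h) ∉ X) ∧ ¬ D.he h ∈ U).card := by
      unfold cutT
      apply Finset.card_bij (fun h _ => flipHalf h)
      · intro h hh
        simp only [Finset.mem_filter, Finset.mem_univ, true_and, flipHalf_flipHalf] at hh ⊢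
        exact ⟨⟨hh.2.2.2, fun hX' => D.not_isT_of_isC (mem_owned.1 hX').1 hh.1⟩, hh.2.2.1⟩
      · intro h _ h' _ hhh
        exact flipHalf_involutive.injective hhh
      · intro h hh
        simp only [Finset.mem_filter, Finset.mem_univ, true_and] at hh
        have hf := ha' h hh.1.1 hh.2
        refine ⟨flipHalf h, ?_, flipHalf_flipHalf h⟩
        simp only [Finset.mem_filter, Finset.mem_univ, true_and, flipHalf_flipHalf]
        exact ⟨isT_of_notMem_owned hW hh.1.1 hh.2 hf hh.1.2, hf, hh.2, hh.1.1⟩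
    have e4 : (Finset.univ.filter fun h =>
          (D.t h ∈ X ∧ D.t (flipHalf h) ∉ X) ∧ D.he h ∈ U).card =
        (Finset.univ.filter fun h => (D.t h ∈ X ∧ D.he h ∈ U) ∧ ¬ D.t (flipHalf h) ∈ X).card := by
      congr 1
      ext h
      simp only [Finset.mem_filter, Finset.mem_univ, true_and]
      tauto
    omega

/-- The cut condition of the factor theorem. -/
def CutCondition (D : GadgetData V E) (ε : ℝ) : Prop :=
  ∀ X ⊆ D.V₀, X ≠ D.V₀ → X.Nonempty →
    (∀ u ∈ X, ∀ v ∈ X, Relation.ReflTransGen (D.AdjIn X) u v) →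
    (Odd (∑ v ∈ X, (D.deg v + D.N v)) → 1 ≤ ε * D.cut X) ∧
    (Odd (∑ v ∈ X, (D.deg v + D.N v) + D.cut X) → 1 ≤ (1 - ε) * D.cut X)

/-- An odd component that avoids the clique has weight at least `1`, unless it contains the gadgets
of all vertices of `V₀`; in that case its weight is at least positive. -/
theorem one_le_compWt_or (h0 : 0 < ε) (h1 : ε < 1) (hs : ∀ v ∈ D.V₀, Even (D.s v))
    (hs1 : ∀ v ∉ D.V₀, 0 < D.s v) (hcut : D.CutCondition ε)
    (hglob : D.V₀.Nonempty → D.cut D.V₀ = 0 → Even (∑ v ∈ D.V₀, (D.deg v + D.N v)))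
    (hW : D.graph.IsOddComponentOff U W) (hK : ¬ D.MeetsClique W) :
    1 ≤ D.compWt U W ε ∨ (D.owned U W = D.V₀ ∧ D.V₀.Nonempty ∧ 0 < D.compWt U W ε) := by
  by_contra! hcon
  obtain ⟨hlt, hcon⟩ := hcon
  have hle := le_compWt h0.le h1.le hW
  have hodd := odd_sum_add_cut h0.le h1.le hs hs1 hW hK hlt
  have hne : (D.owned U W).Nonempty := by
    obtain ⟨x, hx⟩ := Finset.card_pos.1 hW.odd_card.pos
    obtain ⟨v, hv, -⟩ := exists_attached h0.le h1.le hs hW hK hlt hx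
    exact ⟨v, mem_owned.2 hv⟩
  have hsub : D.owned U W ⊆ D.V₀ := fun v hv =>
    (mem_owned.1 hv).mem_V₀ h0.le h1.le hs1 hW hK hlt
  have hconn := fun u hu v hv => owned_connected h0.le h1.le hs hW hK hlt (u := u) (v := v) hu hv
  have hA := cut_le_cutS hW
  have hB := exists_cutDel_add_cutT_eq hW
  set X := D.owned U W with hX
  set a := D.cutS U X
  set b := D.cutDel U X + D.cutT U X with hb
  have hle : ε * a + (1 - ε) * b ≤ D.compWt U W ε := by
    rw [hb]
    push_cast
    exact hle
  have h1' : 0 < 1 - ε := by linarith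
  rcases Nat.eq_zero_or_pos b with hb0 | hbpos
  · have hcutle := hA hb0
    have hodd' : Odd (∑ v ∈ X, (D.deg v + D.N v)) := by rwa [hb0, add_zero] at hodd
    by_cases hXV : X = D.V₀
    · have hw := hcon hXV (hXV ▸ hne)
      have ha0 : a = 0 := by
        by_contra ha
        have : (1 : ℝ) ≤ a := by exact_mod_cast Nat.one_le_iff_ne_zero.2 ha
        have hb' : (0 : ℝ) ≤ (1 - ε) * b := by positivity
        nlinarith
      have hev := hglob (hXV ▸ hne) (by rw [← hXV]; omega)
      rw [← hXV] at hev
      exact Nat.not_even_iff_odd.2 hodd' hev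
    · have h2 := (hcut X hsub hXV hne hconn).1 hodd'
      have h3 : (D.cut X : ℝ) ≤ a := by exact_mod_cast hcutle
      have hb' : (0 : ℝ) ≤ (1 - ε) * b := by positivity
      nlinarith
  · have hb1 : (1 : ℝ) ≤ b := by exact_mod_cast hbpos
    rcases Nat.eq_zero_or_pos a with ha0 | hapos
    · obtain ⟨c, hc, hbc⟩ := hB ha0
      have ha' : (0 : ℝ) ≤ ε * a := by positivity
      by_cases hXV : X = D.V₀
      · have hw := hcon hXV (hXV ▸ hne)
        nlinarith
      · have h2 := (hcut X hsub hXV hne hconn).2 (by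
          rw [hbc, ← add_assoc] at hodd
          rw [Nat.even_iff] at hc
          rw [Nat.odd_iff] at hodd ⊢
          omega)
        have h3 : (D.cut X : ℝ) ≤ b := by
          rw [hbc]
          push_cast
          linarith [(Nat.cast_nonneg c : (0 : ℝ) ≤ c)]
        nlinarith
    · have ha1 : (1 : ℝ) ≤ a := by exact_mod_cast hapos
      nlinarith

end GadgetData

namespace GadgetData

variable {V E : Type*} [Fintype V] [Fintype E] [DecidableEq V] [DecidableEq E]
  {D : GadgetData V E} {U W : Finset D.Vert} {ε : ℝ}

lemma Owns.not_disjoint {W' : Finset D.Vert} (hW : D.graph.IsOddComponentOff U W)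
    (hW' : D.graph.IsOddComponentOff U W') {v : V} (hv : D.Owns U W v) (hv' : D.Owns U W' v) :
    ¬ Disjoint W W' := by
  obtain ⟨-, i, hi, hiW⟩ := hv'
  rw [Finset.not_disjoint_iff]
  exact ⟨_, hv.inn_mem hW hi (Finset.disjoint_left.1 hW'.disjoint hiW), hiW⟩

lemma sum_compWt_le (h0 : 0 ≤ ε) (h1 : ε ≤ 1) (𝒲 : Finset (Finset D.Vert))
    (hdisj : ∀ W ∈ 𝒲, ∀ W' ∈ 𝒲, W ≠ W' → Disjoint W W')
    (h𝒲 : ∀ W ∈ 𝒲, D.graph.IsOddComponentOff U W) :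
    ∑ W ∈ 𝒲, D.compWt U W ε ≤ ∑ x, D.wt U ε x + ∑ v, D.vwt U ε v := by
  classical
  unfold compWt
  rw [Finset.sum_add_distrib]
  refine add_le_add ?_ ?_
  · rw [← Finset.sum_biUnion (t := fun W => W)]
    · exact Finset.sum_le_sum_of_subset_of_nonneg (Finset.subset_univ _)
        fun x _ _ => D.wt_nonneg U h0 h1 x
    · exact fun W hW W' hW' hne => hdisj W hW W' hW' hne
  · rw [← Finset.sum_biUnion (t := fun W => D.owned U W)]
    · exact Finset.sum_le_sum_of_subset_of_nonneg (Finset.subset_univ _)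
        fun x _ _ => D.vwt_nonneg U h1 x
    · intro W hW W' hW' hne
      rw [Function.onFun, Finset.disjoint_left]
      intro v hv hv'
      exact Owns.not_disjoint (h𝒲 W hW) (h𝒲 W' hW') (mem_owned.1 hv) (mem_owned.1 hv')
        (hdisj W hW W' hW' hne)

lemma MeetsClique.not_disjoint {W' : Finset D.Vert} (hW : D.graph.IsOddComponentOff U W)
    (hW' : D.graph.IsOddComponentOff U W') (hK : D.MeetsClique W) (hK' : D.MeetsClique W') :
    ¬ Disjoint W W' := by
  have key : ∃ x ∈ W, ∃ y ∈ W', x = y ∨ D.graph.Adj x y := by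
    rcases hK with ⟨p, hp, hpV⟩ | ⟨k, hk⟩ <;> rcases hK' with ⟨q, hq, hqV⟩ | ⟨l, hl⟩
    · refine ⟨_, hp, _, hq, ?_⟩
      by_cases h : p = q
      · exact .inl (by rw [h])
      · exact .inr ⟨h, .inr ⟨hpV, hqV⟩⟩
    · exact ⟨_, hp, _, hl, .inr hpV⟩
    · exact ⟨_, hk, _, hq, .inr hqV⟩
    · refine ⟨_, hk, _, hl, ?_⟩
      by_cases h : k = l
      · exact .inl (by rw [h])
      · exact .inr h
  obtain ⟨x, hx, y, hy, hxy⟩ := key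
  rw [Finset.not_disjoint_iff]
  rcases hxy with rfl | hxy
  · exact ⟨x, hx, hy⟩
  · exact ⟨y, hW.closed x hx y (Finset.disjoint_left.1 hW'.disjoint hy) hxy, hy⟩

lemma loss_nonpos {v : V} (h : (D.deg v : ℝ) - D.N v ≤ ε * D.deg v ∧
    ε * D.deg v ≤ D.deg v - D.N v + D.s v) : D.loss U ε v ≤ 0 := by
  unfold loss
  split_ifs <;> linarith [h.1, h.2]

lemma loss_lt_one {v : V} (h : (D.deg v : ℝ) - D.N v < ε * D.deg v + 1 ∧
    ε * D.deg v < D.deg v - D.N v + D.s v + 1) : D.loss U ε v < 1 := by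
  unfold loss
  split_ifs <;> linarith [h.1, h.2]

lemma loss_eq_zero {v : V} (h : D.IsC U v) : D.loss U ε v = 0 := by
  simp [loss, h.1, D.not_isT_of_isC h]

/-- The factor theorem: if every degree window contains `ε d(v)`, except that at one vertex `z` of
`V₀` it may miss it by less than `1`, then the cut condition guarantees a factor. A Tutte violator
`U` would leave at least `|U| + 2` odd components, but their total weight is less than `|U| + 1`,
and all of them except the one that meets the clique have weight at least `1`. If some component
has weight less than `1` because it contains the gadgets of all vertices of `V₀`, then there is no
loss at `z`. -/
theorem exists_factor (h0 : 0 < ε) (h1 : ε < 1) (z : V)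
    (hwin : ∀ v, v ≠ z ∨ v ∉ D.V₀ → (D.deg v : ℝ) - D.N v ≤ ε * D.deg v ∧
      ε * D.deg v ≤ D.deg v - D.N v + D.s v)
    (hz : (D.deg z : ℝ) - D.N z < ε * D.deg z + 1 ∧ ε * D.deg z < D.deg z - D.N z + D.s z + 1)
    (hs : ∀ v ∈ D.V₀, Even (D.s v)) (hs1 : ∀ v ∉ D.V₀, 0 < D.s v) (hs2 : ∀ v, D.s v ≤ 2)
    (hcut : D.CutCondition ε)
    (hglob : D.V₀.Nonempty → D.cut D.V₀ = 0 → Even (∑ v ∈ D.V₀, (D.deg v + D.N v)))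
    (hr : (D.V₀ = Finset.univ ∧ D.r = 0) ∨ Even (Fintype.card D.Vert)) :
    ∃ F : Finset E, ∀ v, ∃ k ≤ D.s v, (v ∈ D.V₀ → Even k) ∧
      (Finset.univ.filter fun h => D.t h = v ∧ h.1 ∈ F).card + D.N v = D.deg v + k := by
  classical
  by_contra hF
  have hM : ∀ M : D.graph.Subgraph, ¬ M.IsPerfectMatching := fun M hM =>
    hF (D.exists_factor_of_isPerfectMatching hs M hM)
  obtain ⟨U, 𝒲, hdisj, h𝒲, hcard, heven⟩ := D.graph.exists_family_isOddComponentOff hM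
  have hsum := (sum_compWt_le h0.le h1.le 𝒲 hdisj h𝒲).trans
    (D.sum_wt_add_sum_vwt_le U h0.le h1.le hs2)
  have hloss_le : ∑ v, D.loss U ε v ≤ D.loss U ε z := by
    rw [← Finset.add_sum_erase _ _ (Finset.mem_univ z)]
    have : ∑ v ∈ Finset.univ.erase z, D.loss U ε v ≤ 0 := Finset.sum_nonpos fun v hv =>
      loss_nonpos (hwin v (.inl (Finset.ne_of_mem_erase hv)))
    linarith
  have hcases := fun W hW hK =>
    one_le_compWt_or h0 h1 hs hs1 hcut hglob (h𝒲 W hW) hK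
  -- the components that avoid the clique
  set 𝒜 := 𝒲.filter fun W => ¬ D.MeetsClique W with h𝒜
  set 𝒦 := 𝒲.filter fun W => D.MeetsClique W with h𝒦
  have hsplit : 𝒦.card + 𝒜.card = 𝒲.card := Finset.card_filter_add_card_filter_not _
  have hK1 : 𝒦.card ≤ 1 := by
    rw [Finset.card_le_one]
    intro W hW W' hW'
    rw [h𝒦, Finset.mem_filter] at hW hW'
    by_contra hne
    exact MeetsClique.not_disjoint (h𝒲 W hW.1) (h𝒲 W' hW'.1) hW.2 hW'.2 (hdisj W hW.1 W' hW'.1 hne)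
  have hnonneg : ∀ W, 0 ≤ D.compWt U W ε := fun W => add_nonneg
    (Finset.sum_nonneg fun x _ => D.wt_nonneg U h0.le h1.le x)
    (Finset.sum_nonneg fun v _ => D.vwt_nonneg U h1.le v)
  have hsub : ∑ W ∈ 𝒜, D.compWt U W ε ≤ ∑ W ∈ 𝒲, D.compWt U W ε :=
    Finset.sum_le_sum_of_subset_of_nonneg (Finset.filter_subset _ _) fun W _ _ => hnonneg W
  have hmain : (𝒜.card : ℝ) < U.card + 1 := by
    by_cases hA : ∃ W₀ ∈ 𝒜, ¬ 1 ≤ D.compWt U W₀ ε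
    · obtain ⟨W₀, hW₀, hlt⟩ := hA
      have hW₀' := hW₀
      rw [h𝒜, Finset.mem_filter] at hW₀'
      obtain ⟨hown, -, hpos⟩ := (hcases W₀ hW₀'.1 hW₀'.2).resolve_left hlt
      have hlossz : D.loss U ε z ≤ 0 := by
        by_cases hzV : z ∈ D.V₀
        · rw [← hown] at hzV
          rw [loss_eq_zero (mem_owned.1 hzV).1]
        · exact loss_nonpos (hwin z (.inr hzV))
      have hrest : ((𝒜.erase W₀).card : ℝ) ≤ ∑ W ∈ 𝒜.erase W₀, D.compWt U W ε := by
        rw [Finset.card_eq_sum_ones, Nat.cast_sum]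
        refine Finset.sum_le_sum fun W hW => ?_
        rw [Finset.mem_erase] at hW
        have hW' := hW.2
        rw [h𝒜, Finset.mem_filter] at hW'
        rw [Nat.cast_one]
        refine (hcases W hW'.1 hW'.2).resolve_right ?_
        rintro ⟨hown', ⟨v, hv⟩, -⟩
        have hv1 := hv
        rw [← hown] at hv
        rw [← hown'] at hv1
        exact Owns.not_disjoint (h𝒲 W hW'.1) (h𝒲 W₀ hW₀'.1) (mem_owned.1 hv1) (mem_owned.1 hv)
          (hdisj W hW'.1 W₀ hW₀'.1 hW.1)
      have hc : ((𝒜.erase W₀).card : ℝ) + 1 = 𝒜.card := by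
        exact_mod_cast Finset.card_erase_add_one hW₀
      rw [← Finset.add_sum_erase _ _ hW₀] at hsub
      linarith
    · push Not at hA
      have : (𝒜.card : ℝ) ≤ ∑ W ∈ 𝒜, D.compWt U W ε := by
        rw [Finset.card_eq_sum_ones, Nat.cast_sum]
        refine Finset.sum_le_sum fun W hW => ?_
        rw [Nat.cast_one]
        exact hA W hW
      have := loss_lt_one (U := U) hz
      linarith
  have hmain' : 𝒜.card < U.card + 1 := by exact_mod_cast hmain
  rcases hr with ⟨hV, hr0⟩ | hev
  · have : 𝒦.card = 0 := by
      rw [Finset.card_eq_zero, h𝒦, Finset.filter_eq_empty_iff]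
      rintro W - (⟨p, -, hp⟩ | ⟨k, -⟩)
      · rw [hV] at hp
        exact hp (Finset.mem_univ _)
      · rw [hr0] at k
        exact k.elim0
    omega
  · have := heven hev
    rw [Nat.even_iff] at this
    omega

end GadgetData

/-! ### Bipartite sets and parities of cuts -/

namespace GadgetData

variable {V E : Type*} [Fintype V] [Fintype E] [DecidableEq V] [DecidableEq E]
  {D : GadgetData V E}

lemma card_inside_add_cut (X : Finset V) :
    (Finset.univ.filter fun h => D.t h ∈ X ∧ D.t (flipHalf h) ∈ X).card + D.cut X =
      ∑ v ∈ X, D.deg v := by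
  have h := Finset.card_filter_add_card_filter_not (s := Finset.univ.filter fun h => D.t h ∈ X)
    (fun h => D.t (flipHalf h) ∈ X)
  rw [Finset.filter_filter, Finset.filter_filter] at h
  rw [sum_deg, ← h]
  rfl

lemma even_sum_deg_add_cut (X : Finset V) : Even (∑ v ∈ X, D.deg v + D.cut X) := by
  have h1 := card_inside_add_cut (D := D) X
  have h2 : Even (Finset.univ.filter fun h => D.t h ∈ X ∧ D.t (flipHalf h) ∈ X).card := by
    apply even_card_of_flip
    intro h hh
    simp only [Finset.mem_filter, Finset.mem_univ, true_and, flipHalf_flipHalf] at hh ⊢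
    exact hh.symm
  rw [Nat.even_iff] at h2 ⊢
  omega

/-- For a proper `2`-colouring of the subgraph induced by `X`, the degree sums of the two colour
classes differ by at most the number of edges that leave `X`. -/
lemma abs_sum_sign_mul_deg_le (X : Finset V) (σ : V → ℤ) (hσ : ∀ v, |σ v| = 1)
    (hX : ∀ h, D.t h ∈ X → D.t (flipHalf h) ∈ X → σ (D.t (flipHalf h)) = -σ (D.t h)) :
    |∑ v ∈ X, σ v * D.deg v| ≤ D.cut X := by
  have e1 : ∑ v ∈ X, σ v * D.deg v = ∑ h with D.t h ∈ X, σ (D.t h) := by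
    rw [← Finset.sum_fiberwise_of_maps_to (s := Finset.univ.filter fun h => D.t h ∈ X) (g := D.t)
      (t := X)]
    · refine Finset.sum_congr rfl fun v hv => ?_
      rw [Finset.sum_congr rfl (g := fun _ => σ v), Finset.sum_const, nsmul_eq_mul, mul_comm, deg,
        Finset.filter_filter]
      · congr 3
        ext h
        simp only [Finset.mem_filter, Finset.mem_univ, true_and]
        constructor
        · rintro rfl
          exact ⟨hv, rfl⟩
        · exact fun h => h.2
      · intro h hh
        rw [(Finset.mem_filter.1 hh).2]
    · intro h hh
      exact (Finset.mem_filter.1 hh).2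
  rw [e1, ← Finset.sum_filter_add_sum_filter_not _ (fun h => D.t (flipHalf h) ∈ X)]
  have e2 : ∑ h ∈ (Finset.univ.filter fun h => D.t h ∈ X) with D.t (flipHalf h) ∈ X,
      σ (D.t h) = 0 := by
    refine Finset.sum_involution (fun h _ => flipHalf h) ?_ ?_ ?_ ?_
    · intro h hh
      simp only [Finset.mem_filter, Finset.mem_univ, true_and] at hh
      rw [hX h hh.1 hh.2]
      ring
    · intro h _ _
      exact flipHalf_ne h
    · intro h hh
      simp only [Finset.mem_filter, Finset.mem_univ, true_and, flipHalf_flipHalf] at hh ⊢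
      exact hh.symm
    · intro h _
      exact flipHalf_flipHalf h
  rw [e2, zero_add]
  refine (Finset.abs_sum_le_sum_abs _ _).trans ?_
  simp only [hσ, Finset.filter_filter]
  rw [Finset.sum_const, nsmul_eq_mul, mul_one]
  rfl

/-- If `c d(v)` is an integer for all `v` in a set that induces a bipartite subgraph, and these
integers have odd sum, then the two colour classes have different sums of `c d(v)`. Hence the
boundary of the set has weight at least `1`. -/
lemma one_le_mul_cut (X : Finset V) (σ : V → ℤ) (hσ : ∀ v, |σ v| = 1)
    (hX : ∀ h, D.t h ∈ X → D.t (flipHalf h) ∈ X → σ (D.t (flipHalf h)) = -σ (D.t h))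
    {c : ℝ} (hc : 0 ≤ c) (n : V → ℤ) (hn : ∀ v ∈ X, c * D.deg v = n v) (hodd : Odd (∑ v ∈ X, n v)) :
    1 ≤ c * D.cut X := by
  have h1 := abs_sum_sign_mul_deg_le X σ hσ hX
  have h2 : ((∑ v ∈ X, σ v * n v : ℤ) : ℝ) = c * ((∑ v ∈ X, σ v * D.deg v : ℤ) : ℝ) := by
    push_cast
    rw [Finset.mul_sum]
    refine Finset.sum_congr rfl fun v hv => ?_
    rw [← hn v hv]
    ring
  have h3 : Odd (∑ v ∈ X, σ v * n v) := by
    rw [← ZMod.intCast_eq_one_iff_odd] at hodd ⊢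
    rw [← hodd]
    push_cast
    refine Finset.sum_congr rfl fun v _ => ?_
    have : ((σ v : ℤ) : ZMod 2) = 1 := by
      rw [ZMod.intCast_eq_one_iff_odd]
      rcases (abs_eq (by norm_num)).1 (hσ v) with h | h <;> rw [h] <;> decide
    rw [this, one_mul]
  have h4 : 1 ≤ |∑ v ∈ X, σ v * n v| := by
    rw [← Int.zero_add 1, Int.add_one_le_iff, abs_pos]
    rintro h
    rw [h] at h3
    exact absurd h3 (by decide)
  have h5 : (1 : ℝ) ≤ |((∑ v ∈ X, σ v * n v : ℤ) : ℝ)| := by exact_mod_cast h4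
  have h6 : |((∑ v ∈ X, σ v * D.deg v : ℤ) : ℝ)| ≤ D.cut X := by exact_mod_cast h1
  rw [h2, abs_mul, abs_of_nonneg hc] at h5
  exact h5.trans (mul_le_mul_of_nonneg_left h6 hc)

end GadgetData

/-! ### Half-edges of a multigraph -/

namespace Graph

variable {α β : Type*} (G : Graph α β)

lemma exists_ends (e : E(G)) : ∃ p : V(G) × V(G), G.IsLink e p.1 p.2 := by
  obtain ⟨x, y, h⟩ := G.exists_isLink_of_mem_edgeSet e.2
  exact ⟨(⟨x, h.left_mem⟩, ⟨y, h.right_mem⟩), h⟩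

/-- The vertex of a half-edge, for an arbitrary choice of a first end of every edge. -/
noncomputable def halfEnd (h : E(G) × Bool) : V(G) :=
  if h.2 then (G.exists_ends h.1).choose.2 else (G.exists_ends h.1).choose.1

lemma isLink_halfEnd (h : E(G) × Bool) :
    G.IsLink h.1 (G.halfEnd h) (G.halfEnd (flipHalf h)) := by
  rcases h with ⟨e, b⟩
  have := (G.exists_ends e).choose_spec
  cases b
  · simpa [halfEnd, flipHalf] using this
  · simpa [halfEnd, flipHalf] using this.symm

lemma exists_half_of_isLink {e : β} {x y : α} (h : G.IsLink e x y) :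
    ∃ k : E(G) × Bool, k.1 = e ∧ G.halfEnd k = x ∧ G.halfEnd (flipHalf k) = y := by
  have h1 := G.isLink_halfEnd (⟨e, h.edge_mem⟩, false)
  rcases h1.eq_and_eq_or_eq_and_eq h with ⟨h2, h3⟩ | ⟨h2, h3⟩
  · exact ⟨_, rfl, h2, h3⟩
  · exact ⟨flipHalf (⟨e, h.edge_mem⟩, false), rfl, h3, by rw [flipHalf_flipHalf]; exact h2⟩

variable [Fintype E(G)] [DecidableEq V(G)]

open scoped Classical in
/-- The degree of a vertex in a spanning subgraph is the number of its half-edges there. -/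
lemma degree_restrict (S : Set β) (v : V(G)) :
    (G.restrict S).degree v =
      (Finset.univ.filter fun h : E(G) × Bool => G.halfEnd h = v ∧ (h.1 : β) ∈ S).card := by
  set A : Bool → Finset E(G) := fun b =>
    Finset.univ.filter fun e => G.halfEnd (e, b) = v ∧ (e : β) ∈ S with hA
  have e1 : (Finset.univ.filter fun h : E(G) × Bool => G.halfEnd h = v ∧ (h.1 : β) ∈ S).card =
      (A true).card + (A false).card := by
    simp only [hA, Finset.card_filter, Fintype.sum_prod_type, Fintype.sum_bool,
      Finset.sum_add_distrib]
  have e2 : (G.restrict S).incidenceSet v =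
      Subtype.val '' ((A true ∪ A false : Finset E(G)) : Set E(G)) := by
    ext e
    simp only [mem_incidenceSet, restrict_inc, Set.mem_image, Finset.mem_coe, Finset.mem_union, hA,
      Finset.mem_filter, Finset.mem_univ, true_and]
    constructor
    · rintro ⟨⟨y, hy⟩, hS⟩
      obtain ⟨⟨e', b⟩, rfl, hk, -⟩ := G.exists_half_of_isLink hy
      refine ⟨e', ?_, rfl⟩
      have hk := Subtype.ext hk
      cases b
      · exact .inr ⟨hk, hS⟩
      · exact .inl ⟨hk, hS⟩
    · rintro ⟨e', ⟨rfl, hS⟩ | ⟨rfl, hS⟩, rfl⟩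
      · exact ⟨(G.isLink_halfEnd (e', true)).inc_left, hS⟩
      · exact ⟨(G.isLink_halfEnd (e', false)).inc_left, hS⟩
  have e3 : (G.restrict S).loopSet v =
      Subtype.val '' ((A true ∩ A false : Finset E(G)) : Set E(G)) := by
    ext e
    simp only [mem_loopSet, restrict_isLoopAt, Set.mem_image, Finset.mem_coe, Finset.mem_inter, hA,
      Finset.mem_filter, Finset.mem_univ, true_and]
    constructor
    · rintro ⟨hy, hS⟩
      obtain ⟨⟨e', b⟩, rfl, hk, hk'⟩ := G.exists_half_of_isLink hy
      refine ⟨e', ?_, rfl⟩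
      have hk := Subtype.ext hk
      have hk' := Subtype.ext hk'
      cases b
      · exact ⟨⟨hk', hS⟩, hk, hS⟩
      · exact ⟨⟨hk, hS⟩, hk', hS⟩
    · rintro ⟨e', ⟨⟨h1, hS⟩, h2, -⟩, rfl⟩
      refine ⟨?_, hS⟩
      have := G.isLink_halfEnd (e', true)
      rw [h1] at this
      rw [show flipHalf (e', true) = (e', false) from rfl, h2] at this
      exact this
  rw [degree, e1, e2, e3, Set.ncard_image_of_injective _ Subtype.val_injective,
    Set.ncard_image_of_injective _ Subtype.val_injective, Set.ncard_coe_finset,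
    Set.ncard_coe_finset, Finset.card_union_add_card_inter]

lemma degree_eq_card (v : V(G)) :
    G.degree v = (Finset.univ.filter fun h : E(G) × Bool => G.halfEnd h = v).card := by
  have h := G.degree_restrict E(G) v
  rw [restrict_self] at h
  rw [h]
  congr 1
  ext k
  simp

lemma cutDegree_eq_card (X : Finset V(G)) :
    G.cutDegree (X.map (Function.Embedding.subtype _) : Finset α) =
      (Finset.univ.filter fun h : E(G) × Bool =>
        G.halfEnd h ∈ X ∧ G.halfEnd (flipHalf h) ∉ X).card := by
  have e1 : {e | ∃ x ∈ ((X.map (Function.Embedding.subtype _) : Finset α) : Set α),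
      ∃ y ∉ ((X.map (Function.Embedding.subtype _) : Finset α) : Set α), G.IsLink e x y} =
      (fun h : E(G) × Bool => (h.1 : β)) '' ((Finset.univ.filter fun h : E(G) × Bool =>
        G.halfEnd h ∈ X ∧ G.halfEnd (flipHalf h) ∉ X : Finset _) : Set (E(G) × Bool)) := by
    ext e
    simp only [Set.mem_ofPred_eq, Set.mem_image, Finset.mem_coe, Finset.mem_filter,
      Finset.mem_univ, true_and]
    constructor
    · rintro ⟨x, hx, y, hy, hxy⟩
      obtain ⟨k, hk, rfl, rfl⟩ := G.exists_half_of_isLink hxy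
      refine ⟨k, ⟨?_, ?_⟩, hk⟩
      · simpa using hx
      · simpa using hy
    · rintro ⟨k, ⟨h1, h2⟩, rfl⟩
      exact ⟨_, by simpa using h1, _, by simpa using h2, G.isLink_halfEnd k⟩
  rw [cutDegree, e1, Set.InjOn.ncard_image, Set.ncard_coe_finset]
  rintro ⟨e, b⟩ hk ⟨e', b'⟩ hk' hee
  simp only [Finset.coe_filter, Finset.mem_univ, true_and, Set.mem_ofPred_eq] at hk hk'
  obtain rfl : e = e' := Subtype.ext hee
  by_contra hne
  have : (e, b') = flipHalf (e, b) := by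
    cases b <;> cases b' <;> simp_all [flipHalf]
  rw [this] at hk'
  exact hk.2 hk'.1

end Graph

/-! ### Degree windows around `ε d(v)` -/

namespace Graph

variable {α β : Type*} (G : Graph α β)

open scoped Classical in
/-- The gadget data of a multigraph whose window at `v` starts at `d(v) - N v` and has width
`s v`. -/
noncomputable def gadgetData (V₀ : Finset α) (N s : V(G) → ℕ) (r : ℕ) :
    GadgetData V(G) E(G) where
  t := G.halfEnd
  V₀ := V₀.subtype (· ∈ V(G))
  N := N
  s := s
  r := r

section
variable {G} [Fintype V(G)] [Fintype E(G)] [DecidableEq V(G)] [DecidableEq E(G)]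
  {V₀ : Finset α} {N s : V(G) → ℕ} {r : ℕ}

lemma deg_gadgetData (v : V(G)) : (G.gadgetData V₀ N s r).deg v = G.degree v := by
  rw [degree_eq_card]
  rfl

lemma mem_V₀_gadgetData {v : V(G)} : v ∈ (G.gadgetData V₀ N s r).V₀ ↔ (v : α) ∈ V₀ := by
  simp [gadgetData]

lemma natCast_sum_deg_add {f : α → ZMod 2}
    (hN : ∀ v : V(G), (v : α) ∈ V₀ → (G.degree v : ZMod 2) + N v = f v)
    {X : Finset V(G)} (hX : X ⊆ (G.gadgetData V₀ N s r).V₀) :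
    ((∑ v ∈ X, ((G.gadgetData V₀ N s r).deg v + (G.gadgetData V₀ N s r).N v) : ℕ) : ZMod 2) =
      ∑ v ∈ X.map (Function.Embedding.subtype _), f v := by
  rw [Finset.sum_map, Nat.cast_sum]
  refine Finset.sum_congr rfl fun v hv => ?_
  rw [deg_gadgetData]
  push_cast
  exact hN v (mem_V₀_gadgetData.1 (hX hv))

/-- The cut hypothesis on the multigraph gives the cut condition of the factor theorem. Sets that
induce a bipartite subgraph and have admissible integral values `ε d(v)` need no hypothesis. -/
lemma cutCondition_gadgetData {f : α → ZMod 2} {ε : ℝ} (hε0 : 0 < ε) (hε1 : ε < 1)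
    (hcut : ∀ X : Finset α, X.Nonempty → X ⊂ V₀ →
      ¬ (¬ (G.induce (X : Set α)).IsConnected ∨
        ((G.induce (X : Set α)).IsBipartite ∧
          ∀ v ∈ X, ∃ n : ℤ, ε * G.degree v = n ∧ (n : ZMod 2) = f v)) →
      (∑ v ∈ X, f v = 1 → 1 / ε ≤ (G.cutDegree X : ℝ)) ∧
      (∑ v ∈ X, ((G.degree v : ZMod 2) - f v) = 1 → 1 / (1 - ε) ≤ (G.cutDegree X : ℝ)))
    (hN : ∀ v : V(G), (v : α) ∈ V₀ → (G.degree v : ZMod 2) + N v = f v) :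
    (G.gadgetData V₀ N s r).CutCondition ε := by
  classical
  intro X hXV hXne hXn hconn
  set D := G.gadgetData V₀ N s r with hD
  set Y : Finset α := X.map (Function.Embedding.subtype _) with hY
  have hmemY : ∀ v : V(G), (v : α) ∈ Y ↔ v ∈ X := by
    intro v
    simp [hY]
  have hYex : ∀ y ∈ Y, ∃ v ∈ X, (v : α) = y := by
    intro y hy
    simpa [hY] using hy
  have hε1' : 0 < 1 - ε := by linarith
  have hsum := natCast_sum_deg_add (r := r) (s := s) hN hXV
  have hcutY : G.cutDegree Y = D.cut X := G.cutDegree_eq_card X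
  have hsum1 : Odd (∑ v ∈ X, (D.deg v + D.N v)) → ∑ v ∈ Y, f v = 1 := by
    intro hodd
    rw [← ZMod.natCast_eq_one_iff_odd, hsum] at hodd
    exact hodd
  have hsum2 : Odd (∑ v ∈ X, (D.deg v + D.N v) + D.cut X) →
      ∑ v ∈ Y, ((G.degree v : ZMod 2) - f v) = 1 := by
    intro hodd
    rw [Finset.sum_sub_distrib, ← hsum]
    have h1 := GadgetData.even_sum_deg_add_cut (D := D) X
    have h2 : ∑ v ∈ Y, (G.degree v : ZMod 2) = ((∑ v ∈ X, D.deg v : ℕ) : ZMod 2) := by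
      rw [hY, Finset.sum_map, Nat.cast_sum]
      exact Finset.sum_congr rfl fun v _ => by rw [hD, deg_gadgetData]; rfl
    rw [h2]
    rw [← ZMod.natCast_eq_one_iff_odd] at hodd
    rw [← ZMod.natCast_eq_zero_iff_even] at h1
    push_cast at hodd h1 ⊢
    generalize ∑ v ∈ X, (D.deg v : ZMod 2) = a at *
    generalize ∑ v ∈ X, ((D.deg v : ZMod 2) + D.N v) = b at *
    generalize (D.cut X : ZMod 2) = c at *
    revert a b c
    decide
  by_cases hb : (G.induce (Y : Set α)).IsBipartite ∧
      ∀ v ∈ Y, ∃ n : ℤ, ε * G.degree v = n ∧ (n : ZMod 2) = f v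
  · obtain ⟨⟨c, hc⟩, hint⟩ := hb
    have hint' : ∀ v : V(G), ∃ n : ℤ, v ∈ X → ε * D.deg v = n ∧ (n : ZMod 2) = f v := by
      intro v
      by_cases hv : v ∈ X
      · obtain ⟨n, hn⟩ := hint v ((hmemY v).2 hv)
        refine ⟨n, fun _ => ?_⟩
        rw [hD, deg_gadgetData]
        exact hn
      · exact ⟨0, fun h => absurd h hv⟩
    choose n hn using hint'
    let σ : V(G) → ℤ := fun v => if c v then 1 else -1
    have hσ : ∀ v, |σ v| = 1 := by
      intro v
      simp only [σ]
      split_ifs <;> simp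
    have hσX : ∀ h, D.t h ∈ X → D.t (flipHalf h) ∈ X → σ (D.t (flipHalf h)) = -σ (D.t h) := by
      intro h h1 h2
      have hne := hc (D.t h) (D.t (flipHalf h)) ⟨h.1, by
        rw [induce_isLink]
        exact ⟨G.isLink_halfEnd h, (hmemY _).2 h1, (hmemY _).2 h2⟩⟩
      simp only [σ]
      rcases h3 : c (D.t h) <;> rcases h4 : c (D.t (flipHalf h)) <;> simp_all
    have hnsum : ((∑ v ∈ X, n v : ℤ) : ZMod 2) = ∑ v ∈ Y, f v := by
      rw [hY, Finset.sum_map, Int.cast_sum]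
      exact Finset.sum_congr rfl fun v hv => (hn v hv).2
    constructor
    · intro hodd
      refine GadgetData.one_le_mul_cut X σ hσ hσX hε0.le n (fun v hv => (hn v hv).1) ?_
      rw [← ZMod.intCast_eq_one_iff_odd, hnsum]
      exact hsum1 hodd
    · intro hodd
      refine GadgetData.one_le_mul_cut X σ hσ hσX hε1'.le (fun v => D.deg v - n v) ?_ ?_
      · intro v hv
        push_cast
        linarith [(hn v hv).1]
      · have h2 := hsum2 hodd
        rw [← ZMod.intCast_eq_one_iff_odd, Finset.sum_sub_distrib]
        rw [Finset.sum_sub_distrib, ← hnsum] at h2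
        rw [← h2, hY, Finset.sum_map]
        push_cast
        congr 1
        exact Finset.sum_congr rfl fun v _ => by rw [hD, deg_gadgetData]; rfl
  · have hYne : Y.Nonempty := by
      obtain ⟨v, hv⟩ := hXn
      exact ⟨v, (hmemY v).2 hv⟩
    have hYV : Y ⊂ V₀ := by
      rw [Finset.ssubset_iff_subset_ne]
      constructor
      · intro y hy
        obtain ⟨v, hv, rfl⟩ := hYex y hy
        exact mem_V₀_gadgetData.1 (hXV hv)
      · intro hYV
        refine hXne (Finset.Subset.antisymm hXV fun v hv => ?_)
        rw [← hmemY, hYV]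
        exact mem_V₀_gadgetData.1 hv
    have hYc : (G.induce (Y : Set α)).IsConnected := by
      refine ⟨hYne, fun u hu v hv => ?_⟩
      obtain ⟨u, huX, rfl⟩ := hYex u hu
      obtain ⟨v, hvX, rfl⟩ := hYex v hv
      refine (hconn u huX v hvX).lift Subtype.val ?_
      rintro a b ⟨ha, hb, h, rfl, rfl⟩
      refine ⟨h.1, ?_⟩
      rw [induce_isLink]
      exact ⟨G.isLink_halfEnd h, (hmemY _).2 ha, (hmemY _).2 hb⟩
    obtain ⟨h1, h2⟩ := hcut Y hYne hYV (not_or.2 ⟨not_not.2 hYc, hb⟩)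
    rw [hcutY] at h1 h2
    constructor
    · intro hodd
      have := h1 (hsum1 hodd)
      rwa [div_le_iff₀' hε0] at this
    · intro hodd
      have := h2 (hsum2 hodd)
      rwa [div_le_iff₀' hε1'] at this

/-- In a connected graph, a set of vertices without boundary edges contains all vertices. -/
lemma eq_vertexSet_of_cut_eq_zero (hconn : G.IsConnected) (hV₀ : (V₀ : Set α) ⊆ V(G))
    (hne : (G.gadgetData V₀ N s r).V₀.Nonempty)
    (h0 : (G.gadgetData V₀ N s r).cut (G.gadgetData V₀ N s r).V₀ = 0) : (V₀ : Set α) = V(G) := by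
  refine hV₀.antisymm fun w hw => ?_
  obtain ⟨u, hu⟩ := hne
  have hu' := mem_V₀_gadgetData.1 hu
  have hp := hconn.2 u u.2 w hw
  induction hp with
  | refl => exact hu'
  | @tail x y _ hxy ih =>
    obtain ⟨e, he⟩ := hxy
    obtain ⟨k, -, rfl, rfl⟩ := G.exists_half_of_isLink he
    by_contra hy
    unfold GadgetData.cut at h0
    rw [Finset.card_eq_zero, Finset.filter_eq_empty_iff] at h0
    exact h0 (Finset.mem_univ k) ⟨mem_V₀_gadgetData.2 (ih (Subtype.prop _)),
      fun h => hy (mem_V₀_gadgetData.1 h)⟩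

end

/-- Factors with degrees in prescribed windows: if the windows `{g v, …, g v + s v}` at the vertices
of `V₀` have the right parity, are admissible, and contain `ε d(v)`, except that at one vertex `z`
the window may miss it by less than `1`, then there is a parity factor with degrees in them. -/
theorem exists_isEpsilonParityFactor_of_windows
    (hVfin : V(G).Finite) (hEfin : E(G).Finite) (hconn : G.IsConnected)
    (V₀ V₁ V₁' : Finset α)
    (hV₀ : (V₀ : Set α) ⊆ V(G)) (hV₁ : (V₁ : Set α) ⊆ V(G)) (hV₁' : (V₁' : Set α) ⊆ V(G))
    (h01 : Disjoint V₀ V₁) (h01' : Disjoint V₀ V₁') (h11' : Disjoint V₁ V₁')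
    (f : α → ZMod 2) (ε : ℝ) (hε0 : 0 < ε) (hε1 : ε < 1)
    (hparity : ∑ v ∈ V₀, f v = 0 ∨ (V₀ : Set α) ≠ V(G))
    (hcut : ∀ X : Finset α, X.Nonempty → X ⊂ V₀ →
      ¬ (¬ (G.induce (X : Set α)).IsConnected ∨
        ((G.induce (X : Set α)).IsBipartite ∧
          ∀ v ∈ X, ∃ n : ℤ, ε * G.degree v = n ∧ (n : ZMod 2) = f v)) →
      (∑ v ∈ X, f v = 1 → 1 / ε ≤ (G.cutDegree X : ℝ)) ∧
      (∑ v ∈ X, ((G.degree v : ZMod 2) - f v) = 1 → 1 / (1 - ε) ≤ (G.cutDegree X : ℝ)))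
    (z : α) (hzV : z ∈ V(G)) (g : α → ℤ) (s : α → ℕ)
    (hg : ∀ v ∈ V₀, (g v : ZMod 2) = f v) (hs : ∀ v ∈ V₀, Even (s v)) (hs2 : ∀ v ∈ V₀, s v ≤ 2)
    (hlo : ∀ v ∈ V₀, ⌊ε * G.degree v⌋ - 1 ≤ g v)
    (hhi : ∀ v ∈ V₀, g v + s v ≤ ⌈ε * G.degree v⌉ + 1)
    (hwin : ∀ v ∈ V₀, v ≠ z → (g v : ℝ) ≤ ε * G.degree v ∧ ε * G.degree v ≤ g v + s v)
    (hz : z ∈ V₀ → (g z : ℝ) < ε * G.degree z + 1 ∧ ε * G.degree z < g z + s z + 1) :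
    ∃ F : Graph α β, F.IsEpsilonParityFactor G V₀ V₁ V₁' f ε ∧
      ∀ v ∈ V₀, g v ≤ F.degree v ∧ (F.degree v : ℤ) ≤ g v + s v := by
  classical
  let := hVfin.fintype
  let := hEfin.fintype
  -- outside `V₀` the windows consist of two consecutive integers
  let g' : V(G) → ℤ := fun v => if (v : α) ∈ V₀ then g v else
    if (v : α) ∈ V₁ then ⌈ε * G.degree v⌉ - 1 else ⌊ε * G.degree v⌋
  let s' : V(G) → ℕ := fun v => if (v : α) ∈ V₀ then s v else 1
  have hexact : ∀ v : V(G), (v : α) ≠ z ∨ (v : α) ∉ V₀ →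
      (g' v : ℝ) ≤ ε * G.degree v ∧ ε * G.degree v ≤ g' v + s' v := by
    intro v hv
    by_cases hv0 : (v : α) ∈ V₀
    · simp only [g', s', if_pos hv0]
      exact hwin v hv0 (hv.resolve_right (not_not.2 hv0))
    · simp only [g', s', if_neg hv0]
      split_ifs
      · have h1 := Int.ceil_lt_add_one (ε * G.degree v)
        have h2 := Int.le_ceil (ε * G.degree v)
        push_cast
        constructor <;> linarith
      · have h1 := Int.floor_le (ε * G.degree v)
        have h2 := Int.lt_floor_add_one (ε * G.degree v)
        push_cast
        constructor <;> linarith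
  have hloose : ∀ v : V(G), (g' v : ℝ) < ε * G.degree v + 1 ∧
      ε * G.degree v < g' v + s' v + 1 := by
    intro v
    by_cases hv : (v : α) ≠ z ∨ (v : α) ∉ V₀
    · have := hexact v hv
      constructor <;> linarith [this.1, this.2]
    · push Not at hv
      have hz' := hz (hv.1 ▸ hv.2)
      simp only [g', s', if_pos hv.2]
      rw [hv.1]
      exact hz'
  -- the number of inner vertices is not negative, even at `z`, because `ε < 1`
  have hgd : ∀ v, g' v ≤ G.degree v := by
    intro v
    have h1 := (hloose v).1
    have h2 : ε * G.degree v ≤ G.degree v :=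
      mul_le_of_le_one_left (by positivity) hε1.le
    have h3 : (g' v : ℝ) < (G.degree v : ℤ) + 1 := by push_cast; linarith
    have h4 : g' v < (G.degree v : ℤ) + 1 := by exact_mod_cast h3
    omega
  let N : V(G) → ℕ := fun v => (G.degree v - g' v).toNat
  have hNz : ∀ v, (N v : ℤ) = G.degree v - g' v := fun v =>
    Int.toNat_of_nonneg (sub_nonneg.2 (hgd v))
  have hNr : ∀ v : V(G), (G.degree v : ℝ) - N v = g' v := by
    intro v
    have : ((N v : ℤ) : ℝ) = G.degree v - g' v := by rw [hNz]; push_cast; ring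
    push_cast at this
    linarith
  -- an auxiliary vertex makes the order of the gadget graph even if the clique can absorb it
  let r : ℕ := if (V₀ : Set α) = V(G) then 0 else
    (Fintype.card (E(G) × Bool) + (∑ v, s' v + ∑ v, N v)) % 2
  have hNf : ∀ v : V(G), (v : α) ∈ V₀ → (G.degree v : ZMod 2) + N v = f v := by
    intro v hv
    have h1 : ((N v : ℤ) : ZMod 2) = G.degree v - g' v := by rw [hNz]; push_cast; ring
    have h2 : (g' v : ZMod 2) = f v := by
      simp only [g', if_pos hv]
      exact hg v hv
    rw [Int.cast_natCast, h2] at h1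
    rw [h1]
    generalize (G.degree v : ZMod 2) = a
    generalize f v = b
    revert a b
    decide
  have hcc := cutCondition_gadgetData (N := N) (s := s') (r := r) hε0 hε1 hcut hNf
  have hglob : (G.gadgetData V₀ N s' r).V₀.Nonempty →
      (G.gadgetData V₀ N s' r).cut (G.gadgetData V₀ N s' r).V₀ = 0 →
      Even (∑ v ∈ (G.gadgetData V₀ N s' r).V₀,
        ((G.gadgetData V₀ N s' r).deg v + (G.gadgetData V₀ N s' r).N v)) := by
    intro hne h0
    have h1 := hparity.resolve_right (not_not.2 (eq_vertexSet_of_cut_eq_zero hconn hV₀ hne h0))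
    rw [← ZMod.natCast_eq_zero_iff_even, natCast_sum_deg_add hNf (Finset.Subset.refl _), ← h1]
    congr 1
    ext v
    simp only [Finset.mem_map, Function.Embedding.subtype_apply, mem_V₀_gadgetData]
    constructor
    · rintro ⟨w, hw, rfl⟩
      exact hw
    · intro hv
      exact ⟨⟨v, hV₀ hv⟩, hv, rfl⟩
  have hr : ((G.gadgetData V₀ N s' r).V₀ = Finset.univ ∧ (G.gadgetData V₀ N s' r).r = 0) ∨
      Even (Fintype.card (G.gadgetData V₀ N s' r).Vert) := by
    by_cases hV : (V₀ : Set α) = V(G)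
    · left
      constructor
      · ext v
        simp only [mem_V₀_gadgetData, Finset.mem_univ, iff_true]
        rw [← Finset.mem_coe, hV]
        exact v.2
      · change r = 0
        simp only [r, if_pos hV]
    · right
      have : Fintype.card (G.gadgetData V₀ N s' r).Vert =
          Fintype.card (E(G) × Bool) + (∑ v, s' v + (∑ v, N v + r)) := by
        rw [Fintype.card_sum, Fintype.card_sum, Fintype.card_sum, Fintype.card_sigma,
          Fintype.card_sigma]
        simp only [Fintype.card_fin]
        rfl
      rw [this]
      simp only [r, if_neg hV]
      rw [Nat.even_iff]
      omega
  obtain ⟨F, hF⟩ := GadgetData.exists_factor (D := G.gadgetData V₀ N s' r) hε0 hε1 ⟨z, hzV⟩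
    (by
      intro v hv
      rw [deg_gadgetData, show (G.gadgetData V₀ N s' r).N v = N v from rfl, hNr]
      refine hexact v (hv.imp (fun h h' => h (Subtype.ext h')) fun h h' => h ?_)
      exact mem_V₀_gadgetData.2 h')
    (by
      rw [deg_gadgetData, show (G.gadgetData V₀ N s' r).N ⟨z, hzV⟩ = N ⟨z, hzV⟩ from rfl, hNr]
      exact hloose ⟨z, hzV⟩)
    (by
      intro v hv
      have hv := mem_V₀_gadgetData.1 hv
      change Even (s' v)
      simp only [s', if_pos hv]
      exact hs v hv)
    (by
      intro v hv
      have hv : (v : α) ∉ V₀ := fun h => hv (mem_V₀_gadgetData.2 h)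
      change 0 < s' v
      simp [s', hv])
    (by
      intro v
      change s' v ≤ 2
      simp only [s']
      split_ifs with hv
      · exact hs2 v hv
      · norm_num)
    hcc hglob hr
  have hdeg : ∀ v : V(G), ∃ k ≤ s' v, ((v : α) ∈ V₀ → Even k) ∧
      ((G.restrict (Subtype.val '' (F : Set E(G)))).degree v : ℤ) = g' v + k := by
    intro v
    obtain ⟨k, hk, hke, hkF⟩ := hF v
    refine ⟨k, hk, fun hv => hke (mem_V₀_gadgetData.2 hv), ?_⟩
    have e : (G.restrict (Subtype.val '' (F : Set E(G)))).degree v =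
        (Finset.univ.filter fun h : E(G) × Bool => G.halfEnd h = v ∧ h.1 ∈ F).card := by
      rw [degree_restrict]
      congr 1
      ext h
      simp
    rw [deg_gadgetData] at hkF
    change (Finset.univ.filter fun h : E(G) × Bool => G.halfEnd h = v ∧ h.1 ∈ F).card + N v = _
      at hkF
    rw [← e] at hkF
    have := hNz v
    omega
  refine ⟨G.restrict (Subtype.val '' (F : Set E(G))), ⟨⟨⟨restrict_le, rfl⟩, ?_⟩, ?_, ?_, ?_⟩, ?_⟩
  · intro v hv
    obtain ⟨k, -, hk, he⟩ := hdeg ⟨v, hV₀ hv⟩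
    have h1 : (((G.restrict (Subtype.val '' (F : Set E(G)))).degree v : ℤ) : ZMod 2) =
        (g v : ZMod 2) := by
      rw [he]
      simp only [g', if_pos hv]
      push_cast
      rw [ZMod.natCast_eq_zero_iff_even.2 (hk hv), add_zero]
    rw [Int.cast_natCast, hg v hv] at h1
    exact h1
  · intro v hv
    obtain ⟨k, hks, -, he⟩ := hdeg ⟨v, hV₀ hv⟩
    simp only [g', s', if_pos hv] at he hks
    rw [he]
    have := hlo v hv
    have := hhi v hv
    constructor <;> omega
  · intro v hv
    have hv0 : v ∉ V₀ := Finset.disjoint_right.1 h01 hv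
    obtain ⟨k, hks, -, he⟩ := hdeg ⟨v, hV₁ hv⟩
    simp only [g', s', if_neg hv0, if_pos hv] at he hks
    rw [he]
    constructor <;> omega
  · intro v hv
    have hv0 : v ∉ V₀ := Finset.disjoint_right.1 h01' hv
    have hv1 : v ∉ V₁ := Finset.disjoint_right.1 h11' hv
    obtain ⟨k, hks, -, he⟩ := hdeg ⟨v, hV₁' hv⟩
    simp only [g', s', if_neg hv0, if_neg hv1] at he hks
    rw [he]
    constructor <;> omega
  · intro v hv
    obtain ⟨k, hks, -, he⟩ := hdeg ⟨v, hV₀ hv⟩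
    simp only [g', s', if_pos hv] at he hks
    rw [he]
    constructor <;> omega

end Graph

lemma ZMod.intCast_sub_one_eq {m : ℤ} {φ : ZMod 2} (h : (m : ZMod 2) ≠ φ) :
    ((m - 1 : ℤ) : ZMod 2) = φ := by
  push_cast
  generalize (m : ZMod 2) = a at *
  revert a φ
  decide

/-- A window of the prescribed parity that contains `x`. -/
lemma exists_parity_window (x : ℝ) (φ : ZMod 2) : ∃ (g : ℤ) (s : ℕ), (g : ZMod 2) = φ ∧ Even s ∧
    s ≤ 2 ∧ ⌊x⌋ - 1 ≤ g ∧ g + s ≤ ⌈x⌉ + 1 ∧ (g : ℝ) ≤ x ∧ x ≤ g + s := by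
  have h1 := Int.floor_le x
  have h2 := Int.lt_floor_add_one x
  have h3 := Int.floor_le_ceil x
  by_cases hφ : (⌊x⌋ : ZMod 2) = φ
  · rcases h1.eq_or_lt with hx | hx
    · exact ⟨⌊x⌋, 0, hφ, by decide, by decide, by omega, by push_cast; omega, h1,
        by push_cast; linarith⟩
    · have h4 := Int.lt_ceil.2 hx
      exact ⟨⌊x⌋, 2, hφ, by decide, by decide, by omega, by push_cast; omega, h1,
        by push_cast; linarith⟩
  · exact ⟨⌊x⌋ - 1, 2, ZMod.intCast_sub_one_eq hφ, by decide, by decide, by omega,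
      by push_cast; omega, by push_cast; linarith, by push_cast; linarith⟩

/-- A window of the prescribed parity that misses `x` by less than `1` and has no element below
`⌈x⌉ - 1`. -/
lemma exists_parity_window_ge (x : ℝ) (φ : ZMod 2) : ∃ (g : ℤ) (s : ℕ), (g : ZMod 2) = φ ∧
    Even s ∧ s ≤ 2 ∧ ⌊x⌋ - 1 ≤ g ∧ g + s ≤ ⌈x⌉ + 1 ∧ (g : ℝ) < x + 1 ∧ x < g + s + 1 ∧
    ⌈x⌉ - 1 ≤ g := by
  have h1 := Int.floor_le x
  have h2 := Int.lt_floor_add_one x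
  have h3 := Int.floor_le_ceil x
  have h5 := Int.ceil_le_floor_add_one x
  by_cases hφ : (⌊x⌋ : ZMod 2) = φ
  · exact ⟨⌊x⌋, 0, hφ, by decide, by decide, by omega, by push_cast; omega, by linarith,
      by push_cast; linarith, by omega⟩
  · rcases h1.eq_or_lt with hx | hx
    · have h6 : ⌈x⌉ = ⌊x⌋ := by
        conv_lhs => rw [← hx]
        exact Int.ceil_intCast _
      exact ⟨⌊x⌋ - 1, 2, ZMod.intCast_sub_one_eq hφ, by decide, by decide, by omega,
        by push_cast; omega, by push_cast; linarith, by push_cast; linarith, by omega⟩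
    · refine ⟨⌊x⌋ + 1, 0, ?_, by decide, by decide, by omega,
        by push_cast; omega, by push_cast; linarith, by push_cast; linarith, by omega⟩
      rw [← ZMod.intCast_sub_one_eq hφ]
      push_cast
      generalize (⌊x⌋ : ZMod 2) = a
      revert a
      decide

/-- A window of the prescribed parity that misses `x` by less than `1` and has no element above
`⌊x⌋ + 1`. -/
lemma exists_parity_window_le (x : ℝ) (φ : ZMod 2) : ∃ (g : ℤ) (s : ℕ), (g : ZMod 2) = φ ∧
    Even s ∧ s ≤ 2 ∧ ⌊x⌋ - 1 ≤ g ∧ g + s ≤ ⌈x⌉ + 1 ∧ (g : ℝ) < x + 1 ∧ x < g + s + 1 ∧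
    g + s ≤ ⌊x⌋ + 1 := by
  have h1 := Int.floor_le x
  have h2 := Int.lt_floor_add_one x
  have h3 := Int.floor_le_ceil x
  by_cases hφ : (⌊x⌋ : ZMod 2) = φ
  · exact ⟨⌊x⌋, 0, hφ, by decide, by decide, by omega, by push_cast; omega, by linarith,
      by push_cast; linarith, by push_cast; omega⟩
  · exact ⟨⌊x⌋ - 1, 2, ZMod.intCast_sub_one_eq hφ, by decide, by decide, by omega,
      by push_cast; omega, by push_cast; linarith, by push_cast; linarith, by push_cast; omega⟩

theorem mainTheorem9 {α β : Type*} (G : Graph α β)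
    (hVfin : V(G).Finite) (hEfin : E(G).Finite) (hconn : G.IsConnected)
    (V₀ V₁ V₁' : Finset α)
    (hV₀ : (V₀ : Set α) ⊆ V(G)) (hV₁ : (V₁ : Set α) ⊆ V(G)) (hV₁' : (V₁' : Set α) ⊆ V(G))
    (h01 : Disjoint V₀ V₁) (h01' : Disjoint V₀ V₁') (h11' : Disjoint V₁ V₁')
    (f : α → ZMod 2) (ε : ℝ) (hε0 : 0 < ε) (hε1 : ε < 1)
    (hparity : ∑ v ∈ V₀, f v = 0 ∨ (V₀ : Set α) ≠ V(G))
    (hcut : ∀ X : Finset α, X.Nonempty → X ⊂ V₀ →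
      ¬ (¬ (G.induce (X : Set α)).IsConnected ∨
        ((G.induce (X : Set α)).IsBipartite ∧
          ∀ v ∈ X, ∃ n : ℤ, ε * G.degree v = n ∧ (n : ZMod 2) = f v)) →
      (∑ v ∈ X, f v = 1 → 1 / ε ≤ (G.cutDegree X : ℝ)) ∧
      (∑ v ∈ X, ((G.degree v : ZMod 2) - f v) = 1 → 1 / (1 - ε) ≤ (G.cutDegree X : ℝ))) :
    (∃ F : Graph α β, F.IsEpsilonParityFactor G V₀ V₁ V₁' f ε) ∧
    ∀ z ∈ V₀,
      (∃ F : Graph α β, F.IsEpsilonParityFactor G V₀ V₁ V₁' f ε ∧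
        ⌈ε * G.degree z⌉ - 1 ≤ (F.degree z : ℤ)) ∧
      (∃ F : Graph α β, F.IsEpsilonParityFactor G V₀ V₁ V₁' f ε ∧
        (F.degree z : ℤ) ≤ ⌊ε * G.degree z⌋ + 1) := by
  classical
  have hbase := fun v => exists_parity_window (ε * G.degree v) (f v)
  choose g s hg hs hs2 hlo hhi hge hle using hbase
  -- a window at a single vertex `z` may be replaced by one that misses `ε d(z)` by less than `1`
  have key : ∀ z ∈ V₀, ∀ (m : ℤ) (k : ℕ), (m : ZMod 2) = f z → Even k → k ≤ 2 →
      ⌊ε * G.degree z⌋ - 1 ≤ m → m + k ≤ ⌈ε * G.degree z⌉ + 1 → (m : ℝ) < ε * G.degree z + 1 →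
      ε * G.degree z < m + k + 1 →
      ∃ F : Graph α β, F.IsEpsilonParityFactor G V₀ V₁ V₁' f ε ∧
        m ≤ F.degree z ∧ (F.degree z : ℤ) ≤ m + k := by
    intro z hz m k h1 h2 h3 h4 h5 h6 h7
    have hupd : ∀ (P : α → ℤ → ℕ → Prop), (∀ v, P v (g v) (s v)) → P z m k →
        ∀ v, P v (Function.update g z m v) (Function.update s z k v) := by
      intro P hP hPz v
      by_cases hv : v = z
      · subst hv
        simpa using hPz
      · simpa [hv] using hP v
    obtain ⟨F, hF, hFz⟩ := G.exists_isEpsilonParityFactor_of_windows hVfin hEfin hconn V₀ V₁ V₁'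
      hV₀ hV₁ hV₁' h01 h01' h11' f ε hε0 hε1 hparity hcut z (hV₀ hz)
      (Function.update g z m) (Function.update s z k)
      (fun v _ => hupd (fun v m _ => (m : ZMod 2) = f v) hg h1 v)
      (fun v _ => hupd (fun _ _ k => Even k) hs h2 v)
      (fun v _ => hupd (fun _ _ k => k ≤ 2) hs2 h3 v)
      (fun v _ => hupd (fun v m _ => ⌊ε * G.degree v⌋ - 1 ≤ m) hlo h4 v)
      (fun v _ => hupd (fun v m k => m + k ≤ ⌈ε * G.degree v⌉ + 1) hhi h5 v)
      (fun v _ hv => by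
        rw [Function.update_of_ne hv, Function.update_of_ne hv]
        exact ⟨hge v, hle v⟩)
      (fun _ => by
        rw [Function.update_self, Function.update_self]
        exact ⟨h6, h7⟩)
    have := hFz z hz
    rw [Function.update_self, Function.update_self] at this
    exact ⟨F, hF, this⟩
  refine ⟨?_, fun z hz => ⟨?_, ?_⟩⟩
  · obtain ⟨z, hz⟩ := hconn.1
    obtain ⟨F, hF, -⟩ := G.exists_isEpsilonParityFactor_of_windows hVfin hEfin hconn V₀ V₁ V₁'
      hV₀ hV₁ hV₁' h01 h01' h11' f ε hε0 hε1 hparity hcut z hz g s (fun v _ => hg v)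
      (fun v _ => hs v) (fun v _ => hs2 v) (fun v _ => hlo v) (fun v _ => hhi v)
      (fun v _ _ => ⟨hge v, hle v⟩)
      (fun _ => ⟨by linarith [hge z], by linarith [hle z]⟩)
    exact ⟨F, hF⟩
  · obtain ⟨m, k, h1, h2, h3, h4, h5, h6, h7, h8⟩ :=
      exists_parity_window_ge (ε * G.degree z) (f z)
    obtain ⟨F, hF, hFz⟩ := key z hz m k h1 h2 h3 h4 h5 h6 h7
    exact ⟨F, hF, h8.trans hFz.1⟩
  · obtain ⟨m, k, h1, h2, h3, h4, h5, h6, h7, h8⟩ :=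
      exists_parity_window_le (ε * G.degree z) (f z)
    obtain ⟨F, hF, hFz⟩ := key z hz m k h1 h2 h3 h4 h5 h6 h7
    exact ⟨F, hF, hFz.2.trans h8⟩
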